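/- Let $q$ be an odd prime power, $A=\mathbb{F}_q[T]$, $K=\mathbb{F}_q(T)$, $K_\infty=\mathbb{F}_q((\pi))$ with $\pi=1/T$ the completion of $K$ at the place $\infty$, and $\mathcal{O}_\infty$ its ring of integers. Let $D$ be a division quaternion algebra over $K$ (central, of dimension $4$) that is unramified at $\infty$, and fix an isomorphism $D\otimes_K K_\infty\cong M_2(K_\infty)$. Let $\Lambda$ be a maximal $A$-order of $D$ and let $\Gamma=\Lambda^*$, viewed as a subgroup of $\mathrm{GL}_2(K_\infty)$; the group $\mathbb{F}_q^*$ is contained in $\Gamma$ as scalar matrices. Let $\Gamma$ act on the Bruhat–Tits tree $\mathcal{T}$ of $\mathrm{PGL}_2(K_\infty)$, whose vertices are the classes $[L]$ of $\mathcal{O}_\infty$-lattices $L\subset K_\infty^2$ up to scaling by $K_\infty^*$, with an (oriented) edge $([L],[L'])$ whenever $\pi L\subsetneq L'\subsetneq L$. Write $o(e)$, $t(e)$ for the origin and the target of an edge $e$. A fundamental domain for $\mathcal{T}$ under $\Gamma$ is a pair of subgraphs $\mathcal{S}\subset\mathcal{Y}\subset\mathcal{T}$ such that $\mathcal{S}$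 is a tree whose image in the quotient graph $\Gamma\backslash\mathcal{T}$ is a maximal subtree, the projection $\mathrm{Edg}(\mathcal{Y})\to\mathrm{Edg}(\Gamma\backslash\mathcal{T})$ is bijective, and every edge of $\mathcal{Y}$ has at least one vertex in $\mathcal{S}$. Put $\mathrm{EP}=\{e\in\mathrm{Edg}(\mathcal{Y})\setminus\mathrm{Edg}(\mathcal{S}) : o(e)\in\mathrm{Ver}(\mathcal{S})\}$. An edge pairing is a map $\mathrm{EP}\to\Gamma$, $e\mapsto g_e$, with $g_e\,t(e)\in\mathrm{Ver}(\mathcal{S})$ for all $e$. Let $(\mathcal{S},\mathcal{Y})$ with $(g_e)_{e\in\mathrm{EP}}$ be any fundamental domain with an edge pairing for the action of $\Gamma$ on $\mathcal{T}$ (for instance one produced by an algorithm). Call a vertex $v$ of $\mathcal{S}$ terminal if its image in $\Gamma\backslash\mathcal{T}$ has degree $1$. Then $\Gamma$ is isomorphic to the group $P$ with generators $$g_0,\qquad g_v\ (v\in\mathrm{Ver}(\mathcal{S})\text{ terminal}),\qquad g_e\ (e\in\mathrm{EP})$$ and relations $$g_0^{q-1}=1,\qquad g_v^{q+1}=g_0\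 \text{ for all terminal } v,\qquad [g_e,g_0]=1\ \text{ for all } e\in\mathrm{EP}.$$ More precisely, let $g_0\in\Gamma$ be any generator of $\mathbb{F}_q^*\subset\Gamma$. Then for every terminal vertex $v$ of $\mathcal{S}$ there is a generator $g_v$ of $\mathrm{Stab}_\Gamma(v)$ with $g_v^{q+1}=g_0$; and for every choice of such generators $g_v$ there is an isomorphism $P\to\Gamma$ that sends the symbols $g_0$, $g_v$, $g_e$ to the elements of $\Gamma$ with the same names (in particular to the given edge labels $g_e$). -/

import Mathlib

open scoped Pointwise TensorProduct Polynomial WithZero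

noncomputable section

/-! ### Graphs -/

/-- A (directed multi-)graph with vertex set `V` and set of oriented edges `E`: every edge `e`
has an origin `o e`, a target `t e` and an opposite edge `inv e`. -/
structure MGraph (V E : Type*) where
  o : E → V
  t : E → V
  inv : E → E
  inv_inv : ∀ e, inv (inv e) = e
  o_inv : ∀ e, o (inv e) = t e

namespace MGraph

variable {V E : Type*} (X : MGraph V E)

theorem t_inv (e : E) : X.t (X.inv e) = X.o e := by
  rw [← X.o_inv, X.inv_inv]

/-- `X.IsPath v l w`: the list `l` of edges is a path from `v` to `w`. -/
def IsPath : V → List E → V → Prop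
  | v, [], w => v = w
  | v, e :: l, w => X.o e = v ∧ IsPath (X.t e) l w

/-- The path `l` has no backtracking, i.e. no edge is followed by its opposite. -/
def NoBacktracking (l : List E) : Prop := l.IsChain fun e f => f ≠ X.inv e

/-- A vertex is terminal if its degree is one, i.e. if it is the origin of exactly one edge. -/
def IsTerminal (v : V) : Prop := ∃! e, X.o e = v

/-- A subgraph: a set of vertices and a set of edges, containing with an edge its opposite
and its end points. -/
@[ext]
structure Subgraph where
  verts : Set V
  edges : Set E
  inv_mem : ∀ e ∈ edges, X.inv e ∈ edges
  o_mem : ∀ e ∈ edges, X.o e ∈ verts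

namespace Subgraph

variable {X}

instance : PartialOrder X.Subgraph where
  le S Y := S.verts ⊆ Y.verts ∧ S.edges ⊆ Y.edges
  le_refl _ := ⟨subset_rfl, subset_rfl⟩
  le_trans _ _ _ h h' := ⟨h.1.trans h'.1, h.2.trans h'.2⟩
  le_antisymm _ _ h h' := Subgraph.ext (h.1.antisymm h'.1) (h.2.antisymm h'.2)

/-- Nonempty, and any two vertices are joined by a path inside the subgraph. -/
def Connected (S : X.Subgraph) : Prop :=
  S.verts.Nonempty ∧
    ∀ v ∈ S.verts, ∀ w ∈ S.verts, ∃ l : List E, (∀ e ∈ l, e ∈ S.edges) ∧ X.IsPath v l w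

/-- The subgraph contains no cycle, i.e. no nonempty closed path without backtracking. -/
def CycleFree (S : X.Subgraph) : Prop :=
  ∀ (v : V) (l : List E), l ≠ [] → (∀ e ∈ l, e ∈ S.edges) → X.IsPath v l v →
    ¬ X.NoBacktracking l

/-- A tree is a connected, cycle-free graph. -/
def IsTree (S : X.Subgraph) : Prop := S.Connected ∧ S.CycleFree

/-- A maximal subtree: maximal under inclusion among all subtrees. -/
def IsMaximalSubtree (S : X.Subgraph) : Prop := Maximal IsTree S

end Subgraph

/-- The group `G` acts on the graph `X` by automorphisms. -/
class IsAction (G : Type*) [Group G] [MulAction G V] [MulAction G E] : Prop where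
  o_smul : ∀ (g : G) (e : E), X.o (g • e) = g • X.o e
  t_smul : ∀ (g : G) (e : E), X.t (g • e) = g • X.t e
  inv_smul : ∀ (g : G) (e : E), X.inv (g • e) = g • X.inv e

variable (G : Type*) [Group G] [MulAction G V] [MulAction G E]

/-- The quotient graph `G \ X`: vertices and edges are the `G`-orbits of vertices and edges. -/
def quotient [X.IsAction G] :
    MGraph (MulAction.orbitRel.Quotient G V) (MulAction.orbitRel.Quotient G E) where
  o := Quotient.map' X.o fun e f h => by
    obtain ⟨g, rfl⟩ := h
    exact ⟨g, (IsAction.o_smul g f).symm⟩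
  t := Quotient.map' X.t fun e f h => by
    obtain ⟨g, rfl⟩ := h
    exact ⟨g, (IsAction.t_smul g f).symm⟩
  inv := Quotient.map' X.inv fun e f h => by
    obtain ⟨g, rfl⟩ := h
    exact ⟨g, (IsAction.inv_smul g f).symm⟩
  inv_inv := by
    rintro ⟨e⟩
    exact congrArg (Quotient.mk'' (s₁ := MulAction.orbitRel G E)) (X.inv_inv e)
  o_inv := by
    rintro ⟨e⟩
    exact congrArg (Quotient.mk'' (s₁ := MulAction.orbitRel G V)) (X.o_inv e)

/-- The projection from vertices (or edges) to their `G`-orbits. -/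
def orbitMk {S : Type*} [MulAction G S] (s : S) : MulAction.orbitRel.Quotient G S :=
  Quotient.mk'' s

variable {X} in
/-- The image of a subgraph in the quotient graph. -/
def Subgraph.image [X.IsAction G] (S : X.Subgraph) : (X.quotient G).Subgraph where
  verts := orbitMk G '' S.verts
  edges := orbitMk G '' S.edges
  inv_mem := by
    rintro _ ⟨e, he, rfl⟩
    exact ⟨X.inv e, S.inv_mem e he, rfl⟩
  o_mem := by
    rintro _ ⟨e, he, rfl⟩
    exact ⟨X.o e, S.o_mem e he, rfl⟩

variable {X}

/-- A tree of representatives of `X` modulo `G`: a subtree of `X` whose image in `G \ X` is a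
maximal subtree. -/
def IsTreeOfRepresentatives [X.IsAction G] (S : X.Subgraph) : Prop :=
  S.IsTree ∧ (S.image G).IsMaximalSubtree

/-- A fundamental domain for `X` under `G`: a pair of subgraphs `S ⊆ Y` of `X` such that `S` is a
tree of representatives, the edges of `Y` map bijectively to the edges of `G \ X`, and every edge
of `Y` has at least one of its vertices in `S`. -/
structure IsFundamentalDomain [X.IsAction G] (S Y : X.Subgraph) : Prop where
  le : S ≤ Y
  tree : IsTreeOfRepresentatives G S
  bijOn : Set.BijOn (orbitMk G) Y.edges Set.univ
  meets : ∀ e ∈ Y.edges, X.o e ∈ S.verts ∨ X.t e ∈ S.verts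

/-- The set of paired edges: the edges of `Y` not in `S` whose origin is in `S`. -/
def pairedEdges (S Y : X.Subgraph) : Set E :=
  {e | e ∈ Y.edges ∧ e ∉ S.edges ∧ X.o e ∈ S.verts}

variable {G} in
/-- An edge pairing: a group element `g e` for every paired edge `e`, with `g e • t e ∈ S`. -/
def IsEdgePairing (S Y : X.Subgraph) (g : pairedEdges S Y → G) : Prop :=
  ∀ e : pairedEdges S Y, g e • X.t (e : E) ∈ S.verts

/-- The vertices of `S` whose image in the quotient graph `G \ X` is terminal. -/
def terminalVertices [X.IsAction G] (S : X.Subgraph) : Set V :=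
  {v | v ∈ S.verts ∧ (X.quotient G).IsTerminal (orbitMk G v)}

end MGraph

/-! ### The Bruhat-Tits tree of `PGL₂(K∞)`, where `K = F(T)` and `K∞ = F((1/T))` -/

section BruhatTits

variable (F : Type*) [Field F] [DecidableEq (RatFunc F)]

/-- The completion of `F(T)` at the place `∞`. -/
abbrev KInf := RatFunc.CompletionAtInfty F

/-- The ring of integers of `K∞`. -/
abbrev OInf : Subring (KInf F) := (Valued.v : Valuation (KInf F) ℤᵐ⁰).integer

/-- The uniformizer `π = 1/T` of `K∞`. -/
def unifInf : KInf F := algebraMap (RatFunc F) (KInf F) (RatFunc.X)⁻¹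

/-- The `O∞`-lattices in `K∞²`. -/
abbrev LatticeInf := {L : Submodule (OInf F) (Fin 2 → KInf F) // Submodule.IsLattice (KInf F) L}

/-- Equivalence of lattices: `L ~ c L` for `c ∈ K∞ˣ`. -/
instance homothety : Setoid (LatticeInf F) where
  r L M := ∃ c : (KInf F)ˣ, M.1 = (c : KInf F) • L.1
  iseqv :=
    { refl := fun L => ⟨1, by simp⟩
      symm := by
        rintro L M ⟨c, h⟩
        refine ⟨c⁻¹, ?_⟩
        rw [h, smul_smul, Units.inv_mul, one_smul]
      trans := by
        rintro L M N ⟨c, h⟩ ⟨d, h'⟩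
        refine ⟨d * c, ?_⟩
        rw [h', h, smul_smul, Units.val_mul] }

/-- The vertices of the Bruhat-Tits tree: equivalence classes of lattices. -/
def BTVertex := Quotient (homothety F)

variable {F}

/-- The class of a lattice. -/
def LatticeInf.toVertex (L : LatticeInf F) : BTVertex F := Quotient.mk (homothety F) L

/-- The lattice `g L`, for `g ∈ GL₂(K∞)`. -/
def LatticeInf.map (g : GL (Fin 2) (KInf F)) (L : LatticeInf F) : LatticeInf F :=
  ⟨L.1.map ((Matrix.mulVecLin (g : Matrix (Fin 2) (Fin 2) (KInf F))).restrictScalars (OInf F)), by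
    have hL := L.2
    refine ⟨hL.fg.map _, ?_⟩
    have h : ((L.1.map ((Matrix.mulVecLin (g : Matrix (Fin 2) (Fin 2) (KInf F))).restrictScalars
        (OInf F)) : Submodule (OInf F) (Fin 2 → KInf F)) : Set (Fin 2 → KInf F)) =
        Matrix.mulVecLin (g : Matrix (Fin 2) (Fin 2) (KInf F)) '' (L.1 : Set (Fin 2 → KInf F)) := by
      ext; simp
    rw [h, Submodule.span_image, hL.span_eq_top, Submodule.map_top, LinearMap.range_eq_top]
    intro x
    refine ⟨Matrix.mulVec (g⁻¹ : GL (Fin 2) (KInf F)).val x, ?_⟩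
    rw [Matrix.mulVecLin_apply, Matrix.mulVec_mulVec, Units.mul_inv, Matrix.one_mulVec]⟩

theorem LatticeInf.mem_map (g : GL (Fin 2) (KInf F)) (L : LatticeInf F) (x : Fin 2 → KInf F) :
    x ∈ (L.map g).1 ↔ ∃ y ∈ L.1, Matrix.mulVec g.val y = x := Iff.rfl

theorem LatticeInf.map_one (L : LatticeInf F) : L.map 1 = L := by
  apply Subtype.ext
  ext x
  simp [LatticeInf.mem_map]

theorem LatticeInf.map_mul (g h : GL (Fin 2) (KInf F)) (L : LatticeInf F) :
    L.map (g * h) = (L.map h).map g := by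
  apply Subtype.ext
  ext x
  simp only [LatticeInf.mem_map, Units.val_mul, ← Matrix.mulVec_mulVec]
  constructor
  · rintro ⟨y, hy, rfl⟩
    exact ⟨_, ⟨y, hy, rfl⟩, rfl⟩
  · rintro ⟨_, ⟨y, hy, rfl⟩, rfl⟩
    exact ⟨y, hy, rfl⟩

theorem LatticeInf.map_smul (g : GL (Fin 2) (KInf F)) (L : LatticeInf F) (c : KInf F) :
    (c • L.1).map ((Matrix.mulVecLin g.val).restrictScalars (OInf F)) = c • (L.map g).1 := by
  ext x
  simp only [Submodule.mem_map, Submodule.mem_smul_pointwise_iff_exists, LatticeInf.mem_map]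
  constructor
  · rintro ⟨_, ⟨y, hy, rfl⟩, rfl⟩
    exact ⟨_, ⟨y, hy, rfl⟩, (Matrix.mulVec_smul g.val c y).symm⟩
  · rintro ⟨_, ⟨y, hy, rfl⟩, rfl⟩
    exact ⟨_, ⟨y, hy, rfl⟩, Matrix.mulVec_smul g.val c y⟩

/-- The action `g [L] = [g L]` of `GL₂(K∞)` on the vertices. -/
instance : MulAction (GL (Fin 2) (KInf F)) (BTVertex F) where
  smul g := Quotient.map (LatticeInf.map g) (by
    rintro L M ⟨c, h⟩
    refine ⟨c, ?_⟩
    rw [← LatticeInf.map_smul, ← h]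
    rfl)
  one_smul := by
    rintro ⟨L⟩
    exact congrArg LatticeInf.toVertex L.map_one
  mul_smul g h := by
    rintro ⟨L⟩
    exact congrArg LatticeInf.toVertex (L.map_mul g h)

/-- Adjacency: the two classes have representatives `L`, `L'` with `π L ⊊ L' ⊊ L`. -/
def BTAdj (x y : BTVertex F) : Prop :=
  ∃ L L' : LatticeInf F, L.toVertex = x ∧ L'.toVertex = y ∧ unifInf F • L.1 < L'.1 ∧ L'.1 < L.1

theorem unifInf_ne_zero : unifInf F ≠ 0 := by
  simp [unifInf, RatFunc.X_ne_zero]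

theorem smul_lt_smul_inf {c : KInf F} (hc : c ≠ 0)
    {L M : Submodule (OInf F) (Fin 2 → KInf F)} (h : L < M) : c • L < c • M := by
  have key : ∀ {L M : Submodule (OInf F) (Fin 2 → KInf F)}, c • L ≤ c • M → L ≤ M := by
    intro L M h x hx
    obtain ⟨y, hy, hxy⟩ := h (Submodule.smul_mem_pointwise_smul x c L hx)
    have : y = x := smul_right_injective _ hc hxy
    exact this ▸ hy
  refine lt_of_le_not_ge ?_ fun h' => h.not_ge (key h')
  rintro _ ⟨y, hy, rfl⟩
  exact Submodule.smul_mem_pointwise_smul y c M (h.le hy)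

theorem BTAdj.symm {x y : BTVertex F} (h : BTAdj x y) : BTAdj y x := by
  obtain ⟨L, L', rfl, rfl, h₁, h₂⟩ := h
  have hL := L.2
  let c : (KInf F)ˣ := Units.mk0 (unifInf F) unifInf_ne_zero
  refine ⟨L', ⟨unifInf F • L.1, Submodule.IsLattice.smul (KInf F) L.1 c⟩, rfl, ?_,
    smul_lt_smul_inf unifInf_ne_zero h₂, h₁⟩
  exact (Quotient.sound (⟨c, rfl⟩ : (homothety F).r _ _)).symm

theorem BTAdj.smul {x y : BTVertex F} (h : BTAdj x y) (g : GL (Fin 2) (KInf F)) :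
    BTAdj (g • x) (g • y) := by
  obtain ⟨L, L', rfl, rfl, h₁, h₂⟩ := h
  have hinj : Function.Injective
      ((Matrix.mulVecLin g.val).restrictScalars (OInf F)) := by
    intro x y hxy
    have h : Matrix.mulVec (g⁻¹ : GL (Fin 2) (KInf F)).val (Matrix.mulVec g.val x) =
        Matrix.mulVec (g⁻¹ : GL (Fin 2) (KInf F)).val (Matrix.mulVec g.val y) :=
      congrArg (Matrix.mulVec (g⁻¹ : GL (Fin 2) (KInf F)).val) hxy
    rwa [Matrix.mulVec_mulVec, Matrix.mulVec_mulVec, Units.inv_mul, Matrix.one_mulVec,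
      Matrix.one_mulVec] at h
  refine ⟨L.map g, L'.map g, rfl, rfl, ?_, ?_⟩
  · rw [← LatticeInf.map_smul]
    exact Submodule.map_strictMono_of_injective hinj h₁
  · exact Submodule.map_strictMono_of_injective hinj h₂

variable (F)

/-- The (oriented) edges of the Bruhat-Tits tree. -/
abbrev BTEdge := {p : BTVertex F × BTVertex F // BTAdj p.1 p.2}

/-- The Bruhat-Tits tree. -/
def btTree : MGraph (BTVertex F) (BTEdge F) where
  o e := e.1.1
  t e := e.1.2
  inv e := ⟨(e.1.2, e.1.1), e.2.symm⟩
  inv_inv _ := rfl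
  o_inv _ := rfl

variable {F}

instance : MulAction (GL (Fin 2) (KInf F)) (BTEdge F) where
  smul g e := ⟨g • e.1, e.2.smul g⟩
  one_smul e := Subtype.ext (one_smul _ e.1)
  mul_smul g h e := Subtype.ext (mul_smul g h e.1)

instance (Γ : Subgroup (GL (Fin 2) (KInf F))) : (btTree F).IsAction Γ where
  o_smul _ _ := rfl
  t_smul _ _ := rfl
  inv_smul _ _ := rfl

end BruhatTits

/-! ### Orders in quaternion algebras and their unit groups -/

section Quaternion

variable {F : Type*} [Field F]
variable {D : Type*} [DivisionRing D] [Algebra (RatFunc F) D]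
variable [Algebra F[X] D]

/-- An order of `D` over `A = F[T]`: a subring of `D` that contains `A`, is finitely generated as
an `A`-module and spans `D` over `K = F(T)`. -/
def IsOrder (Λ : Subalgebra F[X] D) : Prop :=
  (Subalgebra.toSubmodule Λ).FG ∧ Submodule.span (RatFunc F) (Λ : Set D) = ⊤

/-- A maximal order: maximal under inclusion among all orders. -/
def IsMaximalOrder (Λ : Subalgebra F[X] D) : Prop := Maximal IsOrder Λ

variable [DecidableEq (RatFunc F)]

/-- The embedding `D → D ⊗ K∞ ≅ M₂(K∞)` given by a splitting `φ` of `D` at `∞`. -/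
def splitEmbedding (φ : KInf F ⊗[RatFunc F] D ≃ₐ[KInf F] Matrix (Fin 2) (Fin 2) (KInf F)) :
    D →+* Matrix (Fin 2) (Fin 2) (KInf F) :=
  (φ : KInf F ⊗[RatFunc F] D →+* Matrix (Fin 2) (Fin 2) (KInf F)).comp
    (Algebra.TensorProduct.includeRight : D →ₐ[RatFunc F] KInf F ⊗[RatFunc F] D).toRingHom

/-- The embedding `Λˣ → GL₂(K∞)`. -/
def unitEmbedding (φ : KInf F ⊗[RatFunc F] D ≃ₐ[KInf F] Matrix (Fin 2) (Fin 2) (KInf F))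
    (Λ : Subalgebra F[X] D) : Λˣ →* GL (Fin 2) (KInf F) :=
  Units.map ((splitEmbedding φ).comp Λ.val.toRingHom : Λ →+* _).toMonoidHom

/-- The group `Γ = Λˣ` of units of `Λ`, as a subgroup of `GL₂(K∞)`. -/
def unitGroup (φ : KInf F ⊗[RatFunc F] D ≃ₐ[KInf F] Matrix (Fin 2) (Fin 2) (KInf F))
    (Λ : Subalgebra F[X] D) : Subgroup (GL (Fin 2) (KInf F)) :=
  (unitEmbedding φ Λ).range

/-- The embedding of `Fˣ` into `Γ` (as scalar matrices). -/
def scalarEmbedding (φ : KInf F ⊗[RatFunc F] D ≃ₐ[KInf F] Matrix (Fin 2) (Fin 2) (KInf F))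
    (Λ : Subalgebra F[X] D) : Fˣ →* unitGroup φ Λ :=
  (unitEmbedding φ Λ).rangeRestrict.comp
    (Units.map ((algebraMap F[X] Λ).comp Polynomial.C).toMonoidHom)

end Quaternion

/-! ### The presentation -/

/-- The generators: `g₀`, one `g_v` for every `v : T`, and one `g_e` for every `e : P`. -/
inductive Gen (T P : Type*)
  | zero : Gen T P
  | vertex (v : T) : Gen T P
  | edge (e : P) : Gen T P

/-- The relations `g₀ ^ (q - 1) = 1`, `g_v ^ (q + 1) = g₀` and `[g_e, g₀] = 1`. -/
def presRels (q : ℕ) (T P : Type*) : Set (FreeGroup (Gen T P)) :=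
  {(FreeGroup.of Gen.zero : FreeGroup (Gen T P)) ^ (q - 1)} ∪
    Set.range (fun v : T =>
      (FreeGroup.of (Gen.vertex v) : FreeGroup (Gen T P)) ^ (q + 1) *
        (FreeGroup.of Gen.zero)⁻¹) ∪
    Set.range (fun e : P =>
      (FreeGroup.of (Gen.edge e) : FreeGroup (Gen T P)) * FreeGroup.of Gen.zero *
        (FreeGroup.of (Gen.edge e))⁻¹ * (FreeGroup.of Gen.zero)⁻¹)

/-- The group generated by `g₀`, `g_v` (`v : T`) and `g_e` (`e : P`) subject to these relations. -/
abbrev PresGroup (q : ℕ) (T P : Type*) := PresentedGroup (presRels q T P)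

end

/-!
The presentation is an instance of Bass-Serre theory, carried out with a ping-pong argument.

*The tree.* `K∞ = F((π))` is a discretely valued field with residue field `F`
(`exists_constInf_sub_lt`), every lattice has a basis (`exists_map_stdLattice`), and the Cartan
decomposition (`exists_smul_diagVertex`) moves every pair of vertices to
`([O∞ ⊕ O∞], [O∞ ⊕ π ^ n O∞])` for a unique `n ≥ 0`, their distance. Exactly one neighbour of a
vertex `x ≠ z` is nearer to `z` (`btDist_of_btAdj`), which is all that is needed of the
Bruhat-Tits graph being a tree (`btTree_isTreeDist`).

*The stabilizers.* For `x` in the order `Λ`, `(det x) ^ 2` is the determinant of the left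
multiplication by `x`, hence a polynomial (`exists_det_sq_eq`), and nonzero if `x ≠ 0`. So an
`x ≠ 0` in `Λ` that preserves a lattice `L` acts on `L / π L` without kernel
(`eq_zero_of_column`). It follows that the elements of `Λ` preserving `L` form a finite field,
embedded into `L / π L = F²` by evaluation at a vector: it has `q` or `q ^ 2` elements. In the first
case the stabilizer of `[L]` in `Γ` is `Fˣ`, which acts trivially on the tree. In the second case
(`residueColumn_bijective`) it is cyclic of order `q ^ 2 - 1` and permutes the neighbours of
`[L]` transitively, so that `[L]` is terminal in the quotient. Edge stabilizers are always `Fˣ`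
(`mem_range_of_smul_edge`).

*The presentation.* The relations hold in `Γ`, so there is a homomorphism from the presented group.
It is surjective because the translates of `S` by its image are closed under adjacency
(`MGraph.IsFundamentalDomain.eq_top_of_stabilizer_le`). Modulo the central generator `g₀`, the
presented group is a quotient of the free product of cyclic groups, of order `q + 1` for the
terminal vertices and infinite for the paired edges. This free product acts faithfully on the tree
by ping-pong (`Monoid.CoprodI.lift_injective_of_ping_pong'`). The ping-pong set of a terminal vertex
`v` is the part of the tree hanging off `S` at `v`; that of a paired edge `e` consists of the two
half-trees at the far ends of `e` and of `g_e ē`, which are both edges leaving `S`.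
See `MGraph.IsFundamentalDomain.exists_mulEquiv_presGroup`.
-/


noncomputable section

/-! ### Half-trees -/

namespace MGraph

variable {V E : Type*} {X : MGraph V E}

variable (X) in
/-- `d` is the distance function of a tree: distances to a fixed vertex change by exactly one
along every edge, and every vertex `y ≠ x` is the origin of exactly one edge pointing towards `x`.
This is the form in which `X` being a tree is used. -/
structure IsTreeDist (d : V → V → ℕ) : Prop where
  comm : ∀ x y, d x y = d y x
  self : ∀ x, d x x = 0
  eq_of_eq_zero : ∀ x y, d x y = 0 → x = y
  step : ∀ e x, d x (X.t e) = d x (X.o e) + 1 ∨ d x (X.o e) = d x (X.t e) + 1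
  exists_closer : ∀ x y, x ≠ y → ∃ e, X.o e = y ∧ d x (X.t e) < d x y
  unique_closer : ∀ x e f, X.o e = X.o f → d x (X.t e) < d x (X.o e) →
    d x (X.t f) < d x (X.o f) → e = f

variable (X) in
/-- The half-tree at the far end of the edge `e`: the vertices nearer to the target of `e` than to
its origin. -/
def halfTree (d : V → V → ℕ) (e : E) : Set V := {w | d w (X.t e) < d w (X.o e)}

theorem mem_halfTree {d : V → V → ℕ} {e : E} {w : V} :
    w ∈ X.halfTree d e ↔ d w (X.t e) < d w (X.o e) := Iff.rfl

theorem smul_mem_halfTree {d : V → V → ℕ} {G : Type*} [Group G] [MulAction G V] [MulAction G E]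
    [X.IsAction G] (hG : ∀ (γ : G) x y, d (γ • x) (γ • y) = d x y) (γ : G) {e : E} {w : V} :
    γ • w ∈ X.halfTree d (γ • e) ↔ w ∈ X.halfTree d e := by
  simp only [mem_halfTree, IsAction.o_smul, IsAction.t_smul, hG]

namespace IsTreeDist

variable {d : V → V → ℕ} (hd : X.IsTreeDist d)
include hd

theorem o_ne_t (e : E) : X.o e ≠ X.t e := by
  intro h
  have := hd.step e (X.o e)
  rw [← h, hd.self] at this
  omega

theorem t_mem_halfTree (e : E) : X.t e ∈ X.halfTree d e := by
  have := hd.step e (X.t e)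
  have := hd.self (X.t e)
  simp only [mem_halfTree]
  omega

theorem mem_halfTree_inv {e : E} {w : V} : w ∈ X.halfTree d (X.inv e) ↔ w ∉ X.halfTree d e := by
  have := hd.step e w
  simp only [mem_halfTree, X.o_inv, X.t_inv]
  omega

theorem o_notMem_halfTree (e : E) : X.o e ∉ X.halfTree d e := by
  rw [← hd.mem_halfTree_inv, ← X.t_inv]
  exact hd.t_mem_halfTree _

/-- The only edge entering the half-tree of `e` is `e` itself. -/
theorem eq_of_crossing {e f : E} (h₁ : X.o f ∉ X.halfTree d e) (h₂ : X.t f ∈ X.halfTree d e) :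
    f = e := by
  simp only [mem_halfTree] at h₁ h₂
  have a := hd.step e (X.o f)
  have b := hd.step e (X.t f)
  have a' := hd.step f (X.o e)
  have b' := hd.step f (X.t e)
  rw [hd.comm (X.o e), hd.comm (X.o e)] at a'
  rw [hd.comm (X.t e), hd.comm (X.t e)] at b'
  have key : d (X.t e) (X.t f) < d (X.t e) (X.o f) := by
    rw [hd.comm (X.t e), hd.comm (X.t e)]; omega
  rcases eq_or_ne (X.o e) (X.o f) with h | h
  · exact hd.unique_closer (X.t e) f e h.symm key (hd.t_mem_halfTree e)
  · obtain ⟨f', hf', hlt⟩ := hd.exists_closer _ _ h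
    have c := hd.step e (X.t f')
    rw [hd.comm (X.o e), hd.comm (X.o e)] at hlt
    have : f' = f := by
      refine hd.unique_closer (X.t e) f' f hf' ?_ key
      rw [hf', hd.comm (X.t e), hd.comm (X.t e)]
      omega
    rw [this] at hlt
    omega

theorem eq_inv_of_crossing {e f : E} (h₁ : X.o f ∈ X.halfTree d e)
    (h₂ : X.t f ∉ X.halfTree d e) : f = X.inv e := by
  refine hd.eq_of_crossing ?_ (hd.mem_halfTree_inv.2 h₂)
  rwa [hd.mem_halfTree_inv, not_not]

/-- Half-trees are connected, and a path in the half-tree of `f` could only leave that of `e` along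
the inverse of `e`, whose target is not in the half-tree of `f`. -/
theorem halfTree_subset {e f : E} (h₁ : X.o f ∈ X.halfTree d e) (h₂ : X.o e ∉ X.halfTree d f) :
    X.halfTree d f ⊆ X.halfTree d e := by
  intro w hw
  induction hn : d (X.t f) w using Nat.strong_induction_on generalizing w with
  | _ n ih =>
    rcases eq_or_ne (X.t f) w with rfl | h
    · by_contra hcon
      have := hd.eq_inv_of_crossing h₁ hcon
      rw [this, X.t_inv] at hw
      rw [← this] at hw
      exact h₂ hw
    · obtain ⟨k, rfl, hk⟩ := hd.exists_closer _ _ h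
      have hmem : X.t k ∈ X.halfTree d f := by
        by_contra hcon
        refine h ?_
        rw [hd.eq_inv_of_crossing hw hcon, X.o_inv]
      have := ih _ (hn ▸ hk) hmem rfl
      by_contra hcon
      rw [hd.eq_of_crossing hcon this] at hw
      exact h₂ hw

theorem disjoint_halfTree {e f : E} (hne : e ≠ f) (h₁ : X.o f ∉ X.halfTree d e)
    (h₂ : X.o e ∉ X.halfTree d f) : Disjoint (X.halfTree d e) (X.halfTree d f) := by
  rw [Set.disjoint_left]
  intro w hw
  have : X.halfTree d e ⊆ X.halfTree d (X.inv f) := by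
    refine hd.halfTree_subset (hd.mem_halfTree_inv.2 h₂) ?_
    rw [X.o_inv]
    intro hcon
    exact hne (hd.eq_of_crossing h₁ hcon).symm
  exact hd.mem_halfTree_inv.1 (this hw)

/-- A tree is connected: a nonempty set of vertices closed under adjacency is everything. -/
theorem mem_of_closed {Q : Set V} {x : V} (hx : x ∈ Q)
    (hQ : ∀ e, X.o e ∈ Q → X.t e ∈ Q) (y : V) : y ∈ Q := by
  induction hn : d x y using Nat.strong_induction_on generalizing y with
  | _ n ih =>
    rcases eq_or_ne x y with rfl | h
    · exact hx
    · obtain ⟨k, rfl, hk⟩ := hd.exists_closer _ _ h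
      have := hQ (X.inv k) (by rw [X.o_inv]; exact ih _ (hn ▸ hk) _ rfl)
      rwa [X.t_inv] at this

end IsTreeDist

/-! ### Paths and subgraphs -/

theorem isPath_append (v w : V) (l l' : List E) :
    X.IsPath v (l ++ l') w ↔ ∃ u, X.IsPath v l u ∧ X.IsPath u l' w := by
  induction l generalizing v with
  | nil => simp [IsPath]
  | cons e l ih => simp [IsPath, ih, and_assoc]

namespace Subgraph

theorem t_mem (S : X.Subgraph) {e : E} (he : e ∈ S.edges) : X.t e ∈ S.verts := by
  rw [← X.o_inv]
  exact S.o_mem _ (S.inv_mem e he)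

theorem path_end_mem (S : X.Subgraph) {l : List E} {v w : V} (hv : v ∈ S.verts)
    (hl : ∀ e ∈ l, e ∈ S.edges) (h : X.IsPath v l w) : w ∈ S.verts := by
  induction l generalizing v with
  | nil => exact (show v = w from h) ▸ hv
  | cons e l ih =>
    exact ih (S.t_mem (hl e (by simp))) (fun f hf => hl f (by simp [hf])) h.2

theorem Connected.subset_of_closed {S : X.Subgraph} (hS : S.Connected) {Q : Set V} {x : V}
    (hx : x ∈ S.verts) (hxQ : x ∈ Q) (hQ : ∀ e ∈ S.edges, X.o e ∈ Q → X.t e ∈ Q) :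
    S.verts ⊆ Q := by
  intro y hy
  obtain ⟨l, hl, hp⟩ := hS.2 x hx y hy
  clear hx hy
  induction l generalizing x with
  | nil => exact (show x = y from hp) ▸ hxQ
  | cons e l ih =>
    obtain ⟨rfl, hp⟩ := hp
    exact ih (hQ e (hl e (by simp)) hxQ) (fun f hf => hl f (by simp [hf])) hp

theorem exists_noBacktracking (S : X.Subgraph) {v w : V} {l : List E}
    (hl : ∀ e ∈ l, e ∈ S.edges) (h : X.IsPath v l w) :
    ∃ l' : List E, (∀ e ∈ l', e ∈ S.edges) ∧ X.IsPath v l' w ∧ X.NoBacktracking l' := by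
  induction l generalizing v with
  | nil => exact ⟨[], by simp, h, List.isChain_nil⟩
  | cons e l ih =>
    obtain ⟨rfl, hp⟩ := h
    obtain ⟨l', hl', hp', hn⟩ := ih (fun f hf => hl f (by simp [hf])) hp
    have he := hl e (by simp)
    cases l' with
    | nil => exact ⟨[e], by simpa using he, ⟨rfl, hp'⟩, List.isChain_singleton _⟩
    | cons f l'' =>
      by_cases hfe : f = X.inv e
      · refine ⟨l'', fun k hk => hl' k (by simp [hk]), ?_, hn.tail⟩
        have := hp'.2
        rwa [hfe, X.t_inv] at this
      · refine ⟨e :: f :: l'', ?_, ⟨rfl, hp'⟩, List.isChain_cons_cons.2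
          ⟨fun h => hfe ?_, hn⟩⟩
        · rintro k (_ | ⟨_, hk⟩)
          exacts [he, hl' k hk]
        · exact h

end Subgraph

end MGraph

/-! ### Fundamental domains -/

namespace MGraph

variable {V E : Type*} {X : MGraph V E}
variable {G : Type*} [Group G] [MulAction G V] [MulAction G E]

theorem orbitMk_eq_iff {A : Type*} [MulAction G A] {a b : A} :
    orbitMk G a = orbitMk G b ↔ ∃ γ : G, γ • b = a := by
  rw [orbitMk, orbitMk, Quotient.eq'', MulAction.orbitRel_apply, MulAction.mem_orbit_iff]

theorem orbitMk_smul {A : Type*} [MulAction G A] (γ : G) (a : A) :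
    orbitMk G (γ • a) = orbitMk G a :=
  orbitMk_eq_iff.2 ⟨γ, rfl⟩

theorem isPath_map [X.IsAction G] {v w : V} {l : List E} (h : X.IsPath v l w) :
    (X.quotient G).IsPath (orbitMk G v) (l.map (orbitMk G)) (orbitMk G w) := by
  induction l generalizing v with
  | nil => exact congrArg _ (show v = w from h)
  | cons e l ih =>
    obtain ⟨rfl, hp⟩ := h
    exact ⟨rfl, ih hp⟩

/-- A maximal subtree contains every vertex adjacent to it: otherwise that vertex could be attached
to the subtree. -/
theorem Subgraph.IsMaximalSubtree.t_mem {S : X.Subgraph} (hS : S.IsMaximalSubtree) {e : E}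
    (he : X.o e ∈ S.verts) : X.t e ∈ S.verts := by
  by_contra ht
  let S' : X.Subgraph :=
    { verts := insert (X.t e) S.verts
      edges := {e, X.inv e} ∪ S.edges
      inv_mem := by
        rintro f ((rfl | rfl) | hf)
        · simp
        · simp [X.inv_inv]
        · exact Or.inr (S.inv_mem f hf)
      o_mem := by
        rintro f ((rfl | rfl) | hf)
        · exact Or.inr he
        · rw [X.o_inv]; simp
        · exact Or.inr (S.o_mem f hf) }
  have hedge : ∀ f ∈ S'.edges, X.o f ∈ S.verts → f = e ∨ f ∈ S.edges := by
    rintro f ((rfl | rfl) | hf) ho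
    · exact Or.inl rfl
    · rw [X.o_inv] at ho; exact absurd ho ht
    · exact Or.inr hf
  have hedge' : ∀ f ∈ S'.edges, X.o f ∉ S.verts → f = X.inv e := by
    rintro f ((rfl | rfl) | hf) ho
    · exact absurd he ho
    · rfl
    · exact absurd (S.o_mem f hf) ho
  -- A path without backtracking in `S'` that starts in `S` leaves `S` at most at its last edge.
  have hpath : ∀ (l : List E) (v w : V), v ∈ S.verts → (∀ f ∈ l, f ∈ S'.edges) →
      X.IsPath v l w → X.NoBacktracking l →
      (∀ f ∈ l, f ∈ S.edges) ∨ ∃ l', (∀ f ∈ l', f ∈ S.edges) ∧ l = l' ++ [e] := by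
    intro l
    induction l with
    | nil => simp
    | cons f l ih =>
      rintro v w hv hl ⟨rfl, hp⟩ hn
      rcases hedge f (hl f (by simp)) hv with rfl | hf
      · cases l with
        | nil => exact Or.inr ⟨[], by simp⟩
        | cons k l =>
          have hk := hedge' k (hl k (by simp)) (by rw [hp.1]; exact ht)
          exact absurd hk (List.isChain_cons_cons.1 hn).1
      · rcases ih _ w (S.t_mem hf) (fun k hk => hl k (by simp [hk])) hp hn.tail
          with h | ⟨l', h, rfl⟩
        · left
          rintro k (_ | ⟨_, hk⟩)
          exacts [hf, h k hk]
        · right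
          refine ⟨f :: l', ?_, rfl⟩
          rintro k (_ | ⟨_, hk⟩)
          exacts [hf, h k hk]
  have hconn : S'.Connected := by
    refine ⟨⟨_, Or.inl rfl⟩, ?_⟩
    have h1 : ∀ v ∈ S'.verts, ∃ l, (∀ f ∈ l, f ∈ S'.edges) ∧ X.IsPath v l (X.o e) := by
      rintro v (rfl | hv)
      · exact ⟨[X.inv e], by simp [S'], X.o_inv e, X.t_inv e⟩
      · obtain ⟨l, hl, hp⟩ := hS.1.1.2 v hv _ he
        exact ⟨l, fun f hf => Or.inr (hl f hf), hp⟩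
    have h2 : ∀ w ∈ S'.verts, ∃ l, (∀ f ∈ l, f ∈ S'.edges) ∧ X.IsPath (X.o e) l w := by
      rintro v (rfl | hv)
      · exact ⟨[e], by simp [S'], rfl, rfl⟩
      · obtain ⟨l, hl, hp⟩ := hS.1.1.2 _ he v hv
        exact ⟨l, fun f hf => Or.inr (hl f hf), hp⟩
    intro v hv w hw
    obtain ⟨l, hl, hp⟩ := h1 v hv
    obtain ⟨l', hl', hp'⟩ := h2 w hw
    refine ⟨l ++ l', ?_, (isPath_append _ _ _ _).2 ⟨_, hp, hp'⟩⟩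
    intro f hf
    rcases List.mem_append.1 hf with hf | hf
    exacts [hl f hf, hl' f hf]
  have hcyc : S'.CycleFree := by
    intro v l hne hl hp hn
    -- A cycle based in `S` stays in `S`. One based at the new vertex leaves it along `ē` and
    -- returns along `e`; removing these two edges gives a cycle in `S`, or else the cycle is
    -- `[ē, e]`, which backtracks.
    by_cases hv : v ∈ S.verts
    · rcases hpath l v v hv hl hp hn with h | ⟨l', h, rfl⟩
      · exact hS.1.2 v l hne h hp hn
      · obtain ⟨u, -, -, hu⟩ := (isPath_append _ _ _ _).1 hp
        exact ht ((show X.t e = v from hu) ▸ hv)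
    · have hv' : v = X.t e := by
        cases l with
        | nil => exact absurd rfl hne
        | cons f l =>
          rw [← hp.1, hedge' f (hl f (by simp)) (by rw [hp.1]; exact hv), X.o_inv]
      cases l with
      | nil => exact absurd rfl hne
      | cons f l =>
        obtain rfl := hedge' f (hl f (by simp)) (by rw [hp.1]; exact hv)
        have hp2 := hp.2
        rw [X.t_inv] at hp2
        rcases hpath l _ v he (fun k hk => hl k (by simp [hk])) hp2 hn.tail with h | ⟨l', h, rfl⟩
        · exact hv (S.path_end_mem he h hp2)
        · obtain ⟨u, hu, hu', -⟩ := (isPath_append _ _ _ _).1 hp2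
          rw [← hu'] at hu
          cases l' with
          | nil => exact (List.isChain_cons_cons.1 hn).1 (X.inv_inv e).symm
          | cons k l' =>
            exact hS.1.2 _ _ (by simp) h hu (List.isChain_append.1 hn.tail).1
  exact ht ((hS.2 (y := S') ⟨hconn, hcyc⟩ ⟨fun x hx => Or.inr hx, fun x hx => Or.inr hx⟩).1
    (Or.inl rfl))

namespace IsFundamentalDomain

variable [X.IsAction G] {S Y : X.Subgraph} (hSY : IsFundamentalDomain G S Y)
include hSY

theorem eq_of_orbit {e f : E} (he : e ∈ Y.edges) (hf : f ∈ Y.edges)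
    (h : orbitMk G e = orbitMk G f) : e = f :=
  hSY.bijOn.injOn he hf h

theorem exists_smul_mem (e : E) : ∃ γ : G, γ • e ∈ Y.edges := by
  obtain ⟨f, hf, h⟩ := hSY.bijOn.surjOn (Set.mem_univ (orbitMk G e))
  obtain ⟨γ, rfl⟩ := orbitMk_eq_iff.1 h
  exact ⟨γ, hf⟩

/-- A path without backtracking in `S` that joins equivalent vertices would map to a cycle in the
maximal subtree. -/
theorem eq_of_orbit_verts {v w : V} (hv : v ∈ S.verts) (hw : w ∈ S.verts)
    (h : orbitMk G v = orbitMk G w) : v = w := by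
  obtain ⟨l, hl, hp⟩ := hSY.tree.1.1.2 v hv w hw
  obtain ⟨l, hl, hp, hn⟩ := S.exists_noBacktracking hl hp
  by_contra hne
  refine hSY.tree.2.1.2 (orbitMk G v) (l.map (orbitMk G)) ?_ ?_ ?_ ?_
  · rintro h0
    rw [List.map_eq_nil_iff] at h0
    subst h0
    exact hne hp
  · intro e he
    obtain ⟨f, hf, rfl⟩ := List.mem_map.1 he
    exact ⟨f, hl f hf, rfl⟩
  · have := isPath_map (G := G) hp
    rwa [← h] at this
  · rw [NoBacktracking, List.isChain_map]
    refine List.IsChain.imp_of_mem_imp ?_ hn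
    intro e f he hf hef hcon
    exact hef (hSY.eq_of_orbit (hSY.le.2 (hl f hf)) (hSY.le.2 (S.inv_mem e (hl e he))) hcon)

variable {d : V → V → ℕ} (hd : X.IsTreeDist d)
include hd

theorem exists_smul_eq (x : V) : ∃ γ : G, ∃ s ∈ S.verts, γ • s = x := by
  have h : ∀ x, orbitMk G x ∈ (S.image G).verts := by
    obtain ⟨v, hv⟩ := hSY.tree.1.1.1
    refine hd.mem_of_closed (Q := {x | orbitMk G x ∈ (S.image G).verts}) (x := v) ⟨v, hv, rfl⟩ ?_
    intro e he
    exact hSY.tree.2.t_mem (e := orbitMk G e) he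
  obtain ⟨s, hs, h⟩ := h x
  obtain ⟨γ, rfl⟩ := orbitMk_eq_iff.1 h.symm
  exact ⟨γ, s, hs, rfl⟩

/-- The action is without inversions: both orientations of an edge of `Y` are in `Y`, so that they
are inequivalent. -/
theorem smul_ne_inv (γ : G) (e : E) : γ • e ≠ X.inv e := by
  intro h
  obtain ⟨η, hη⟩ := hSY.exists_smul_mem e
  have := hSY.eq_of_orbit hη (Y.inv_mem _ hη) (by
    rw [IsAction.inv_smul, ← h, orbitMk_smul, orbitMk_smul, orbitMk_smul])
  refine hd.o_ne_t (η • e) ?_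
  rw [← X.o_inv, ← this]

/-- Both end points in the subtree `S` force an edge to be in `S`. -/
theorem mem_edges {e : E} (ho : X.o e ∈ S.verts) (ht : X.t e ∈ S.verts) : e ∈ S.edges := by
  by_contra hcon
  refine hd.o_notMem_halfTree e ?_
  refine hSY.tree.1.1.subset_of_closed (Q := X.halfTree d e) ht (hd.t_mem_halfTree e) ?_ ho
  intro f hf hof
  by_contra htf
  rw [hd.eq_inv_of_crossing hof htf] at hf
  exact hcon (X.inv_inv e ▸ S.inv_mem _ hf)

theorem notMem_halfTree {e : E} (ho : X.o e ∈ S.verts) (ht : X.t e ∉ S.verts) {s : V}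
    (hs : s ∈ S.verts) : s ∉ X.halfTree d e := by
  refine hSY.tree.1.1.subset_of_closed (Q := (X.halfTree d e)ᶜ) ho (hd.o_notMem_halfTree e) ?_ hs
  intro f hf hof htf
  rw [hd.eq_of_crossing hof htf] at hf
  exact ht (S.t_mem hf)

theorem disjoint_halfTree {e f : E} (hne : e ≠ f) (heo : X.o e ∈ S.verts) (het : X.t e ∉ S.verts)
    (hfo : X.o f ∈ S.verts) (hft : X.t f ∉ S.verts) :
    Disjoint (X.halfTree d e) (X.halfTree d f) :=
  hd.disjoint_halfTree hne (hSY.notMem_halfTree hd heo het hfo)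
    (hSY.notMem_halfTree hd hfo hft heo)

/-- Terminal vertices of the quotient lift to leaves of `S`. -/
theorem exists_edge_of_isTerminal {v : V} (hv : v ∈ terminalVertices G S) :
    ∃ e ∈ S.edges, X.o e = v := by
  have hex : ∃ w ∈ S.verts, w ≠ v := by
    by_contra! hcon
    obtain ⟨ε, hε, huniq⟩ := hv.2
    induction ε using Quotient.inductionOn' with | _ e =>
    have h : orbitMk G (X.inv e) = orbitMk G e := by
      refine huniq _ ?_
      obtain ⟨γ, s, hs, h⟩ := hSY.exists_smul_eq hd (X.o (X.inv e))
      change orbitMk G (X.o (X.inv e)) = orbitMk G v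
      rw [← h, orbitMk_smul, hcon s hs]
    obtain ⟨γ, h⟩ := orbitMk_eq_iff.1 h
    exact hSY.smul_ne_inv hd γ e h
  obtain ⟨w, hw, hwv⟩ := hex
  obtain ⟨l, hl, hp⟩ := hSY.tree.1.1.2 v hv.1 w hw
  cases l with
  | nil => exact absurd hp.symm hwv
  | cons e l => exact ⟨e, hl e (by simp), hp.1⟩

omit hd in
/-- All edges of `Y` at a terminal vertex coincide. -/
theorem eq_of_isTerminal {v : V} (hv : v ∈ terminalVertices G S) {e f : E} (he : e ∈ Y.edges)
    (hf : f ∈ Y.edges) (heo : orbitMk G (X.o e) = orbitMk G v)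
    (hfo : orbitMk G (X.o f) = orbitMk G v) : e = f :=
  hSY.eq_of_orbit he hf (hv.2.unique (y₁ := orbitMk G e) (y₂ := orbitMk G f) heo hfo)

theorem mem_halfTree_of_isTerminal {v : V} (hv : v ∈ terminalVertices G S) {e : E}
    (he : e ∈ S.edges) (heo : X.o e = v) {s : V} (hs : s ∈ S.verts) (hsv : s ≠ v) :
    s ∈ X.halfTree d e := by
  have : S.verts ⊆ insert v (X.halfTree d e) := by
    refine hSY.tree.1.1.subset_of_closed hv.1 (Or.inl rfl) ?_
    rintro f hf (hof | hof)
    · right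
      rw [hSY.eq_of_isTerminal hv (hSY.le.2 hf) (hSY.le.2 he) (by rw [hof]) (by rw [heo])]
      exact hd.t_mem_halfTree e
    · by_cases h : X.t f ∈ X.halfTree d e
      · exact Or.inr h
      · left
        rw [hd.eq_inv_of_crossing hof h, X.t_inv, heo]
  exact (this hs).resolve_left hsv

end IsFundamentalDomain

end MGraph

/-! ### Ping-pong -/

/-- A ping-pong lemma for free products. The letter `h ≠ 1` of `H i` maps the set `A i` into
`X i`, and `X j` lies in `A i` for `j ≠ i`. Unlike in `Monoid.CoprodI.lift_injective_of_ping_pong`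
there is no condition on the number or the size of the groups; it is replaced by a point of each
`A i` outside of all the `X j`. -/
theorem Monoid.CoprodI.lift_injective_of_ping_pong' {ι : Type*} {G : Type*} [Group G]
    {H : ι → Type*} [∀ i, Group (H i)] (f : ∀ i, H i →* G) {α : Type*} [MulAction G α]
    (X A : ι → Set α) (hX : ∀ i, ∀ h : H i, h ≠ 1 → ∀ x ∈ A i, f i h • x ∈ X i)
    (hXA : ∀ i j, i ≠ j → X i ⊆ A j) (hA : ∀ i, ∃ x ∈ A i, ∀ j, x ∉ X j) :
    Function.Injective (Monoid.CoprodI.lift f) := by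
  classical
  have key : ∀ {i j} (w : Monoid.CoprodI.NeWord H i j), ∀ x ∈ A j,
      Monoid.CoprodI.lift f w.prod • x ∈ X i := by
    intro i j w
    induction w with
    | singleton x hne => simpa using hX _ x hne
    | append w₁ hne w₂ ih₁ ih₂ =>
      intro x hx
      rw [Monoid.CoprodI.NeWord.append_prod, map_mul, mul_smul]
      exact ih₁ _ (hXA _ _ hne.symm (ih₂ x hx))
  rw [injective_iff_map_eq_one]
  intro m hm
  obtain ⟨w, rfl⟩ := Monoid.CoprodI.Word.equiv.symm.surjective m
  change Monoid.CoprodI.lift f w.prod = 1 at hm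
  by_contra hne
  have hw : w ≠ Monoid.CoprodI.Word.empty := by
    rintro rfl
    exact hne Monoid.CoprodI.Word.prod_empty
  obtain ⟨i, j, w', rfl⟩ := Monoid.CoprodI.NeWord.of_word w hw
  obtain ⟨x, hx, hxX⟩ := hA j
  have := key w' x hx
  rw [Monoid.CoprodI.NeWord.prod, hm, one_smul] at this
  exact hxX i this

/-- The homomorphism from the cyclic group of order `n` (infinite if `n = 0`) that sends the
generator to `x`, where `x ^ n = 1`. -/
def zmodPow {G : Type*} [Group G] (n : ℕ) (x : G) (hx : x ^ n = 1) :
    Multiplicative (ZMod n) →* G :=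
  AddMonoidHom.toMultiplicativeLeft (ZMod.lift n
    ⟨(zmultiplesHom (Additive G)) (Additive.ofMul x), by
    simp [← ofMul_pow, hx]⟩)

theorem zmodPow_intCast {G : Type*} [Group G] (n : ℕ) (x : G) (hx : x ^ n = 1) (k : ℤ) :
    zmodPow n x hx (Multiplicative.ofAdd (k : ZMod n)) = x ^ k := by
  simp [zmodPow, ZMod.lift_coe]

theorem zmodPow_one {G : Type*} [Group G] (n : ℕ) (x : G) (hx : x ^ n = 1) :
    zmodPow n x hx (Multiplicative.ofAdd 1) = x := by
  simpa using zmodPow_intCast n x hx 1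

namespace PresGroup

variable {q : ℕ} {T P : Type*}

theorem zero_pow : (PresentedGroup.of Gen.zero : PresGroup q T P) ^ (q - 1) = 1 := by
  rw [PresentedGroup.of, ← map_pow]
  exact PresentedGroup.one_of_mem (Or.inl (Or.inl rfl))

theorem vertex_pow (v : T) :
    (PresentedGroup.of (Gen.vertex v) : PresGroup q T P) ^ (q + 1) =
      PresentedGroup.of Gen.zero := by
  rw [← mul_inv_eq_one]
  exact PresentedGroup.one_of_mem (Or.inl (Or.inr ⟨v, rfl⟩))

theorem commute_edge (e : P) :
    Commute (PresentedGroup.of (Gen.edge e) : PresGroup q T P) (PresentedGroup.of Gen.zero) := by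
  rw [commute_iff_eq, ← mul_inv_eq_iff_eq_mul, ← mul_inv_eq_one]
  exact PresentedGroup.one_of_mem (Or.inr ⟨e, rfl⟩)

variable (q T P) in
theorem zero_mem_center :
    (PresentedGroup.of Gen.zero : PresGroup q T P) ∈ Subgroup.center (PresGroup q T P) := by
  rw [← Subgroup.centralizer_univ, ← Subgroup.coe_top, ← PresentedGroup.closure_range_of,
    Subgroup.centralizer_closure, Subgroup.mem_centralizer_iff]
  rintro _ ⟨x | v | e, rfl⟩
  · rfl
  · rw [← vertex_pow v]
    exact (Commute.refl _).pow_right _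
  · exact commute_edge e

/-- The subgroup generated by the central generator. -/
abbrev zeroSubgroup (q : ℕ) (T P : Type*) : Subgroup (PresGroup q T P) :=
  Subgroup.zpowers (PresentedGroup.of Gen.zero)

instance : (zeroSubgroup q T P).Normal := by
  refine ⟨fun n hn g => ?_⟩
  have : n ∈ Subgroup.center (PresGroup q T P) :=
    Subgroup.zpowers_le.2 (zero_mem_center q T P) hn
  rw [Subgroup.mem_center_iff.1 this g, mul_inv_cancel_right]
  exact hn

/-- The orders of the free factors of the group modulo its central generator. -/
def factorOrder (q : ℕ) (T P : Type*) : T ⊕ P → ℕ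
  | Sum.inl _ => q + 1
  | Sum.inr _ => 0

/-- The generators of the free factors. -/
def factorGen : T ⊕ P → PresGroup q T P
  | Sum.inl v => PresentedGroup.of (Gen.vertex v)
  | Sum.inr e => PresentedGroup.of (Gen.edge e)

theorem factorGen_pow (i : T ⊕ P) :
    (QuotientGroup.mk' (zeroSubgroup q T P) (factorGen i)) ^ factorOrder q T P i = 1 := by
  rcases i with v | e
  · rw [← map_pow, factorOrder, factorGen, vertex_pow]
    exact (QuotientGroup.eq_one_iff _).2 (Subgroup.mem_zpowers _)
  · exact pow_zero _

/-- The map of a free factor to the quotient by the central generator. -/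
def factorHom (i : T ⊕ P) :
    Multiplicative (ZMod (factorOrder q T P i)) →* PresGroup q T P ⧸ zeroSubgroup q T P :=
  zmodPow _ _ (factorGen_pow i)

/-- Modulo its central generator, the group is a quotient of the free product of cyclic groups. -/
theorem lift_factorHom_surjective :
    Function.Surjective (Monoid.CoprodI.lift (factorHom (q := q) (T := T) (P := P))) := by
  rw [← MonoidHom.range_eq_top, eq_top_iff]
  have h : (⊤ : Subgroup (PresGroup q T P)) ≤ ((Monoid.CoprodI.lift
      (factorHom (q := q) (T := T) (P := P))).range).comap (QuotientGroup.mk' _) := by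
    rw [← PresentedGroup.closure_range_of, Subgroup.closure_le]
    have hgen : ∀ i : T ⊕ P, QuotientGroup.mk' (zeroSubgroup q T P) (factorGen i) ∈
        (Monoid.CoprodI.lift (factorHom (q := q) (T := T) (P := P))).range := fun i =>
      ⟨Monoid.CoprodI.of (Multiplicative.ofAdd 1), by
        rw [Monoid.CoprodI.lift_of, factorHom, zmodPow_one]⟩
    rintro _ ⟨x | v | e, rfl⟩
    · have : QuotientGroup.mk' (zeroSubgroup q T P) (PresentedGroup.of Gen.zero) = 1 :=
        (QuotientGroup.eq_one_iff _).2 (Subgroup.mem_zpowers _)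
      rw [SetLike.mem_coe, Subgroup.mem_comap, this]
      exact one_mem _
    · exact hgen (Sum.inl v)
    · exact hgen (Sum.inr e)
  intro x _
  obtain ⟨x, rfl⟩ := QuotientGroup.mk'_surjective _ x
  exact h (Subgroup.mem_top x)

/-- A homomorphism that is injective on the powers of the central generator is injective as soon
as it induces an injection of the free product of cyclic groups. -/
theorem injective_of_lift {Q R : Type*} [Group Q] [Group R] (Φ : PresGroup q T P →* Q)
    (p : Q →* R) (hp : p (Φ (PresentedGroup.of Gen.zero)) = 1)
    (h₀ : orderOf (Φ (PresentedGroup.of Gen.zero)) = q - 1)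
    (f : ∀ i : T ⊕ P, Multiplicative (ZMod (factorOrder q T P i)) →* R)
    (hf : ∀ i, f i (Multiplicative.ofAdd 1) = p (Φ (factorGen i)))
    (hinj : Function.Injective (Monoid.CoprodI.lift f)) : Function.Injective Φ := by
  let ψ : PresGroup q T P ⧸ zeroSubgroup q T P →* R :=
    QuotientGroup.lift _ (p.comp Φ) (by
      exact Subgroup.zpowers_le.2 hp)
  have hlift : Monoid.CoprodI.lift f = ψ.comp (Monoid.CoprodI.lift factorHom) := by
    refine Monoid.CoprodI.ext_hom _ _ fun i => MonoidHom.ext fun x => ?_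
    obtain ⟨k, hk⟩ := ZMod.intCast_surjective (Multiplicative.toAdd x)
    have hx : x = Multiplicative.ofAdd 1 ^ k := by
      rw [← ofAdd_zsmul, zsmul_one, hk]; rfl
    simp only [MonoidHom.comp_apply, Monoid.CoprodI.lift_of]
    rw [hx, map_zpow, map_zpow, map_zpow, hf, factorHom, zmodPow_one]
    rfl
  rw [injective_iff_map_eq_one]
  intro x hx
  have hx0 : (x : PresGroup q T P ⧸ zeroSubgroup q T P) = 1 := by
    obtain ⟨w, hw⟩ := lift_factorHom_surjective (x : PresGroup q T P ⧸ zeroSubgroup q T P)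
    have : w = 1 := by
      apply hinj
      rw [hlift, map_one, MonoidHom.comp_apply, hw]
      change p (Φ x) = 1
      rw [hx, map_one]
    rw [← hw, this, map_one]
  obtain ⟨k, rfl⟩ := Subgroup.mem_zpowers_iff.1 ((QuotientGroup.eq_one_iff _).1 hx0)
  rw [map_zpow, ← orderOf_dvd_iff_zpow_eq_one, h₀] at hx
  obtain ⟨m, rfl⟩ := hx
  rw [zpow_mul, zpow_natCast, zero_pow, one_zpow]

end PresGroup

/-! ### The presentation of a group acting on a tree -/

namespace MGraph

variable {V E : Type*} {X : MGraph V E}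
variable {G : Type*} [Group G] [MulAction G V] [MulAction G E] [X.IsAction G]

/-- For a paired edge `e`, the edge `g_e ē`; it starts in `S`, as `e` does. -/
def partner {S Y : X.Subgraph} (g : pairedEdges S Y → G) (e : pairedEdges S Y) : E :=
  X.inv (g e • (e : E))

namespace IsFundamentalDomain

variable {S Y : X.Subgraph} (hSY : IsFundamentalDomain G S Y)
variable {g : pairedEdges S Y → G} (hg : IsEdgePairing S Y g)

section

variable {d : V → V → ℕ} (hd : X.IsTreeDist d)

include hSY hd in
theorem t_pairedEdge_notMem (e : pairedEdges S Y) : X.t (e : E) ∉ S.verts := fun h =>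
  e.2.2.1 (hSY.mem_edges hd e.2.2.2 h)

include hg in
theorem o_partner_mem (e : pairedEdges S Y) : X.o (partner g e) ∈ S.verts := by
  rw [partner, X.o_inv, IsAction.t_smul]
  exact hg e

include hSY hg hd in
theorem t_partner_notMem (e : pairedEdges S Y) : X.t (partner g e) ∉ S.verts := by
  rw [partner, X.t_inv]
  intro h
  have hmem : g e • (e : E) ∈ S.edges := by
    refine hSY.mem_edges hd h ?_
    rw [IsAction.t_smul]
    exact hg e
  refine e.2.2.1 ?_
  rwa [← hSY.eq_of_orbit (hSY.le.2 hmem) e.2.1 (orbitMk_smul _ _)]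

theorem orbitMk_partner (e : pairedEdges S Y) :
    orbitMk G (partner g e) = orbitMk G (X.inv (e : E)) := by
  rw [partner, IsAction.inv_smul, orbitMk_smul]

include hSY in
theorem partner_injective {e f : pairedEdges S Y} (h : partner g e = partner g f) : e = f := by
  have := hSY.eq_of_orbit (Y.inv_mem _ e.2.1) (Y.inv_mem _ f.2.1) (by
    rw [← orbitMk_partner (g := g), ← orbitMk_partner (g := g), h])
  exact Subtype.ext (by rw [← X.inv_inv (e : E), this, X.inv_inv])

include hSY hd in
theorem ne_partner (e f : pairedEdges S Y) : (e : E) ≠ partner g f := by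
  intro h
  have := hSY.eq_of_orbit e.2.1 (Y.inv_mem _ f.2.1) (by rw [← orbitMk_partner (g := g), h])
  refine hSY.t_pairedEdge_notMem hd f ?_
  rw [← X.o_inv, ← this]
  exact e.2.2.2

/-- The ping-pong set of a paired edge `e`: the half-trees of `e` and of its partner. -/
def edgeSet (d : V → V → ℕ) (g : pairedEdges S Y → G) (e : pairedEdges S Y) : Set V :=
  X.halfTree d e ∪ X.halfTree d (partner g e)

include hSY hg hd in
theorem notMem_edgeSet (e : pairedEdges S Y) {s : V} (hs : s ∈ S.verts) : s ∉ edgeSet d g e := by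
  rintro (h | h)
  · exact hSY.notMem_halfTree hd e.2.2.2 (hSY.t_pairedEdge_notMem hd e) hs h
  · exact hSY.notMem_halfTree hd (o_partner_mem hg e) (hSY.t_partner_notMem hg hd e) hs h

include hSY hg hd in
theorem disjoint_edgeSet {e f : pairedEdges S Y} (h : e ≠ f) :
    Disjoint (edgeSet d g e) (edgeSet d g f) := by
  have he := hSY.t_pairedEdge_notMem hd
  have hp := hSY.t_partner_notMem hg hd
  have ho := o_partner_mem hg
  simp only [edgeSet, Set.disjoint_union_left, Set.disjoint_union_right]
  refine ⟨⟨?_, ?_⟩, ?_, ?_⟩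
  · exact hSY.disjoint_halfTree hd (fun h' => h (Subtype.ext h')) e.2.2.2 (he e) f.2.2.2 (he f)
  · exact hSY.disjoint_halfTree hd (hSY.ne_partner hd f e).symm (ho e) (hp e) f.2.2.2 (he f)
  · exact hSY.disjoint_halfTree hd (hSY.ne_partner hd e f) e.2.2.2 (he e) (ho f) (hp f)
  · exact hSY.disjoint_halfTree hd (fun h' => h (hSY.partner_injective h'))
      (ho e) (hp e) (ho f) (hp f)

include hSY hg hd in
/-- Nontrivial powers of `g_e` map everything outside the ping-pong set of `e` into it. -/
theorem zpow_smul_mem_edgeSet (hG : ∀ (γ : G) x y, d (γ • x) (γ • y) = d x y)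
    (e : pairedEdges S Y) {k : ℤ} (hk : k ≠ 0) {x : V} (hx : x ∉ edgeSet d g e) :
    g e ^ k • x ∈ edgeSet d g e := by
  have hdisj := hSY.disjoint_halfTree hd (hSY.ne_partner hd e e) e.2.2.2
    (hSY.t_pairedEdge_notMem hd e) (o_partner_mem hg e) (hSY.t_partner_notMem hg hd e)
  have h1 : ∀ y, y ∉ X.halfTree d e → g e • y ∈ X.halfTree d (partner g e) := by
    intro y hy
    rwa [partner, hd.mem_halfTree_inv, smul_mem_halfTree hG]
  have h2 : ∀ y, y ∉ X.halfTree d (partner g e) → (g e)⁻¹ • y ∈ X.halfTree d e := by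
    intro y hy
    rw [partner, hd.mem_halfTree_inv, not_not] at hy
    rwa [← smul_mem_halfTree hG (g e), smul_inv_smul]
  have h3 : ∀ n : ℕ, g e ^ (n + 1) • x ∈ X.halfTree d (partner g e) := by
    intro n
    induction n with
    | zero => rw [zero_add, pow_one]; exact h1 x fun h => hx (Or.inl h)
    | succ n ih => rw [pow_succ', mul_smul]; exact h1 _ fun h => Set.disjoint_left.1 hdisj h ih
  have h4 : ∀ n : ℕ, (g e)⁻¹ ^ (n + 1) • x ∈ X.halfTree d e := by
    intro n
    induction n with
    | zero => rw [zero_add, pow_one]; exact h2 x fun h => hx (Or.inr h)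
    | succ n ih => rw [pow_succ', mul_smul]; exact h2 _ fun h => Set.disjoint_left.1 hdisj ih h
  obtain ⟨n, rfl | rfl⟩ := k.eq_nat_or_neg
  · obtain ⟨m, rfl⟩ := Nat.exists_eq_succ_of_ne_zero (by simpa using hk : n ≠ 0)
    exact Or.inr (by rw [zpow_natCast]; exact h3 m)
  · obtain ⟨m, rfl⟩ := Nat.exists_eq_succ_of_ne_zero (by simpa using hk : n ≠ 0)
    exact Or.inl (by rw [zpow_neg, zpow_natCast, ← inv_pow]; exact h4 m)

include hSY hg hd in
/-- The ping-pong set of a paired edge lies in the half-tree pointing from a terminal vertex into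
`S`, as no paired edge is attached to a terminal vertex. -/
theorem edgeSet_subset {v : V} (hv : v ∈ terminalVertices G S) {ε : E} (hε : ε ∈ S.edges)
    (hεo : X.o ε = v) (e : pairedEdges S Y) : edgeSet d g e ⊆ X.halfTree d ε := by
  have key : ∀ f, X.o f ∈ S.verts → X.t f ∉ S.verts → X.o f ≠ v →
      X.halfTree d f ⊆ X.halfTree d ε := by
    intro f ho ht hne
    refine hd.halfTree_subset (hSY.mem_halfTree_of_isTerminal hd hv hε hεo ho hne) ?_
    rw [hεo]
    exact hSY.notMem_halfTree hd ho ht hv.1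
  have hεv : orbitMk G (X.o ε) = orbitMk G v := by rw [hεo]
  refine Set.union_subset (key _ e.2.2.2 (hSY.t_pairedEdge_notMem hd e) fun h => ?_)
    (key _ (o_partner_mem hg e) (hSY.t_partner_notMem hg hd e) fun h => ?_)
  · refine e.2.2.1 ?_
    rwa [hSY.eq_of_isTerminal hv e.2.1 (hSY.le.2 hε) (by rw [h]) hεv]
  · refine e.2.2.1 ?_
    have := hSY.eq_of_isTerminal hv (Y.inv_mem _ e.2.1) (hSY.le.2 hε) (by
      rw [partner, X.o_inv, IsAction.t_smul] at h
      rw [X.o_inv, ← h, orbitMk_smul]) hεv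
    rw [← X.inv_inv (e : E), this]
    exact S.inv_mem _ hε

include hSY hd in
/-- The part of the tree hanging off `S` at a terminal vertex lies in the half-tree pointing from
any other terminal vertex into `S`. -/
theorem mem_halfTree_of_notMem {v w : V} (hv : v ∈ terminalVertices G S)
    (hw : w ∈ terminalVertices G S) (hvw : v ≠ w) {ε η : E} (hε : ε ∈ S.edges) (hη : η ∈ S.edges)
    (hεo : X.o ε = v) (hηo : X.o η = w) {x : V} (hx : x ∉ X.halfTree d ε) :
    x ∈ X.halfTree d η := by
  rw [← hd.mem_halfTree_inv] at hx
  by_cases h : X.t ε = w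
  · rwa [hSY.eq_of_isTerminal hw (hSY.le.2 hη) (hSY.le.2 (S.inv_mem _ hε)) (by rw [hηo])
      (by rw [X.o_inv, h])]
  · refine hd.halfTree_subset ?_ ?_ hx
    · rw [X.o_inv]
      exact hSY.mem_halfTree_of_isTerminal hd hw hη hηo (S.t_mem hε) h
    · rw [hd.mem_halfTree_inv, not_not, hηo]
      exact hSY.mem_halfTree_of_isTerminal hd hv hε hεo hw.1 hvw.symm

include hd in
/-- An element fixing `v` but not the edge `ε` at `v` moves the half-tree of `ε` into another branch
at `v`. -/
theorem smul_mem_of_stabilizer (hG : ∀ (γ : G) x y, d (γ • x) (γ • y) = d x y) {v : V} {ε : E}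
    (hεo : X.o ε = v) {γ : G} (hγ : γ • v = v) (hγε : γ • ε ≠ ε) {x : V}
    (hx : x ∈ X.halfTree d ε) : γ • x ≠ v ∧ γ • x ∉ X.halfTree d ε := by
  have ho : X.o (γ • ε) = v := by rw [IsAction.o_smul, hεo, hγ]
  have hmem : γ • x ∈ X.halfTree d (γ • ε) := (smul_mem_halfTree hG γ).2 hx
  refine ⟨?_, ?_⟩
  · intro h
    refine hd.o_notMem_halfTree (γ • ε) ?_
    rwa [ho, ← h]
  · refine Set.disjoint_left.1 (hd.disjoint_halfTree hγε ?_ ?_) hmem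
    · rw [hεo, ← ho]; exact hd.o_notMem_halfTree _
    · rw [ho, ← hεo]; exact hd.o_notMem_halfTree _

include hSY hg hd in
/-- The elements `g_e` together with the stabilizers of the vertices of `S` generate the group:
the translates of `S` by the subgroup they generate are closed under adjacency. -/
theorem eq_top_of_stabilizer_le (N : Subgroup G) (hN : ∀ v ∈ S.verts, MulAction.stabilizer G v ≤ N)
    (hNg : ∀ e, g e ∈ N) : N = ⊤ := by
  have hQ : ∀ x : V, ∃ γ ∈ N, ∃ s ∈ S.verts, γ • s = x := by
    obtain ⟨v, hv⟩ := hSY.tree.1.1.1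
    refine hd.mem_of_closed (Q := {x | ∃ γ ∈ N, ∃ s ∈ S.verts, γ • s = x})
      ⟨1, one_mem _, v, hv, one_smul _ _⟩ ?_
    rintro f ⟨γ, hγ, s, hs, hf⟩
    obtain ⟨η, hη⟩ := hSY.exists_smul_mem (γ⁻¹ • f)
    set e := η • γ⁻¹ • f with he
    have hoe : X.o e = η • s := by rw [he, IsAction.o_smul, IsAction.o_smul, ← hf, inv_smul_smul]
    have hte : X.t f = γ • η⁻¹ • X.t e := by
      rw [he, IsAction.t_smul, IsAction.t_smul, inv_smul_smul, smul_inv_smul]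
    -- An element of `G` moving `s` to a vertex of `S` fixes `s`.
    have hfix : ∀ δ : G, δ • s ∈ S.verts → δ ∈ N := fun δ hδ =>
      hN s hs (hSY.eq_of_orbit_verts hδ hs (orbitMk_smul _ _))
    by_cases hoS : X.o e ∈ S.verts
    · have hηN : η ∈ N := hfix η (hoe ▸ hoS)
      by_cases htS : X.t e ∈ S.verts
      · exact ⟨γ * η⁻¹, mul_mem hγ (inv_mem hηN), _, htS, by rw [hte, mul_smul]⟩
      · let e' : pairedEdges S Y := ⟨e, hη, fun h => htS (S.t_mem h), hoS⟩
        refine ⟨γ * η⁻¹ * (g e')⁻¹, mul_mem (mul_mem hγ (inv_mem hηN)) (inv_mem (hNg _)), _,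
          hg e', ?_⟩
        rw [mul_smul, inv_smul_smul, hte, mul_smul]
    · have htS := (hSY.meets e hη).resolve_left hoS
      let e' : pairedEdges S Y := ⟨X.inv e, Y.inv_mem _ hη,
        fun h => hoS (by rw [← X.t_inv]; exact S.t_mem h), by rwa [X.o_inv]⟩
      have h : g e' * η ∈ N := by
        apply hfix
        rw [mul_smul, ← hoe, ← X.t_inv]
        exact hg e'
      have hηN : η ∈ N := by simpa using mul_mem (inv_mem (hNg e')) h
      exact ⟨γ * η⁻¹, mul_mem hγ (inv_mem hηN), _, htS, by rw [hte, mul_smul]⟩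
  rw [eq_top_iff]
  intro γ _
  obtain ⟨v, hv⟩ := hSY.tree.1.1.1
  obtain ⟨δ, hδ, s, hs, h⟩ := hQ (γ • v)
  have hsv : s = v := hSY.eq_of_orbit_verts hs hv (by
    rw [← orbitMk_smul δ s, h, orbitMk_smul])
  subst hsv
  have : δ⁻¹ * γ ∈ N := hN s hs (by
    rw [MulAction.mem_stabilizer_iff, mul_smul, ← h, inv_smul_smul])
  simpa using mul_mem hδ this

end

include hSY hg in
/-- Let `G` act on a tree such that a central cyclic group `⟨g₀⟩` acts trivially and contains the
stabilizers of all edges and of the vertices that are not terminal in the quotient, while the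
stabilizer of a terminal vertex `v` is generated by a `(q + 1)`-st root `g_v` of `g₀`, of order
`q + 1` modulo `⟨g₀⟩`. Then `g₀`, the `g_v` and the edge labels `g_e` present `G`. -/
theorem exists_mulEquiv_presGroup {d : V → V → ℕ} (hd : X.IsTreeDist d)
    (hG : ∀ (γ : G) x y, d (γ • x) (γ • y) = d x y) {q : ℕ} (g₀ : G)
    (hg₀ : ∀ x : V, g₀ • x = x) (horder : orderOf g₀ = q - 1)
    (hcomm : ∀ e, Commute (g e) g₀)
    (hedge : ∀ (γ : G) (e : E), γ • e = e → γ ∈ Subgroup.zpowers g₀)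
    (hvert : ∀ v ∈ S.verts, v ∉ terminalVertices G S →
      MulAction.stabilizer G v ≤ Subgroup.zpowers g₀)
    (gv : terminalVertices G S → G)
    (hgv : ∀ v, Subgroup.zpowers (gv v) = MulAction.stabilizer G (v : V))
    (hgv_pow : ∀ v, gv v ^ (q + 1) = g₀)
    (hgv_dvd : ∀ v (k : ℤ), gv v ^ k ∈ Subgroup.zpowers g₀ → ((q + 1 : ℕ) : ℤ) ∣ k) :
    ∃ Φ : PresGroup q (terminalVertices G S) (pairedEdges S Y) ≃* G,
      Φ (PresentedGroup.of Gen.zero) = g₀ ∧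
      (∀ v, Φ (PresentedGroup.of (Gen.vertex v)) = gv v) ∧
      ∀ e, Φ (PresentedGroup.of (Gen.edge e)) = g e := by
  let gen : Gen (terminalVertices G S) (pairedEdges S Y) → G := fun
    | .zero => g₀
    | .vertex v => gv v
    | .edge e => g e
  have hrel : ∀ r ∈ presRels q (terminalVertices G S) (pairedEdges S Y),
      FreeGroup.lift gen r = 1 := by
    rintro r ((rfl | ⟨v, rfl⟩) | ⟨e, rfl⟩)
    · simp [gen, ← horder, pow_orderOf_eq_one]
    · simp [gen, hgv_pow]
    · simp [gen, (hcomm e).eq]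
  let Φ := PresentedGroup.toGroup hrel
  have hΦ : ∀ x, Φ (PresentedGroup.of x) = gen x := fun x => PresentedGroup.toGroup.of hrel
  -- The range contains the labels `g_e` and the stabilizers of the vertices of `S`.
  have hsurj : Function.Surjective Φ := by
    rw [← MonoidHom.range_eq_top]
    have h₀ : g₀ ∈ Φ.range := ⟨_, hΦ .zero⟩
    refine hSY.eq_top_of_stabilizer_le hg hd _ (fun v hv => ?_) fun e => ⟨_, hΦ (.edge e)⟩
    by_cases hvt : v ∈ terminalVertices G S
    · rw [← hgv ⟨v, hvt⟩, Subgroup.zpowers_le]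
      exact ⟨_, hΦ (.vertex ⟨v, hvt⟩)⟩
    · exact (hvert v hv hvt).trans (Subgroup.zpowers_le.2 h₀)
  have hinj : Function.Injective Φ := by
    -- Ping-pong for the action on `V`. The nontrivial elements of the factor of a terminal vertex
    -- `v`, where `ε v` is the edge of `S` at `v`, move the half-tree of `ε v` into the other
    -- branches at `v`; the nontrivial powers of `g_e` move the complement of `edgeSet d g e` into
    -- `edgeSet d g e`.
    let p := MulAction.toPermHom G V
    have hp : p g₀ = 1 := Equiv.ext hg₀
    have hf : ∀ i : terminalVertices G S ⊕ pairedEdges S Y,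
        p (Φ (PresGroup.factorGen i)) ^ PresGroup.factorOrder q _ _ i = 1 := by
      rintro (v | e)
      · rw [PresGroup.factorGen, hΦ, ← map_pow]
        exact (congrArg p (hgv_pow v)).trans hp
      · exact pow_zero _
    have hfk : ∀ i (k : ℤ) (x : V), zmodPow _ _ (hf i) (Multiplicative.ofAdd (k : ZMod _)) • x =
        Φ (PresGroup.factorGen i) ^ k • x := by
      intro i k x
      rw [zmodPow_intCast, ← map_zpow]
      rfl
    choose ε hε hεo using fun v : terminalVertices G S => hSY.exists_edge_of_isTerminal hd v.2
    refine PresGroup.injective_of_lift Φ p (by rw [hΦ]; exact hp) (by rw [hΦ]; exact horder)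
      (fun i => zmodPow _ _ (hf i)) (fun i => zmodPow_one _ _ _)
      (Monoid.CoprodI.lift_injective_of_ping_pong' _ (α := V)
        (Sum.elim (fun v => {x | x ≠ v ∧ x ∉ X.halfTree d (ε v)}) (edgeSet d g))
        (Sum.elim (fun v => X.halfTree d (ε v)) fun e => (edgeSet d g e)ᶜ) ?_ ?_ ?_)
    · intro i h hne x hx
      obtain ⟨k, hk⟩ := ZMod.intCast_surjective (Multiplicative.toAdd h)
      obtain rfl : h = Multiplicative.ofAdd (k : ZMod _) := by rw [hk]; rfl
      rw [hfk]
      have hk0 : ¬ ((PresGroup.factorOrder q _ _ i : ℕ) : ℤ) ∣ k := by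
        rw [← ZMod.intCast_zmod_eq_zero_iff_dvd]
        exact fun h0 => hne (by rw [h0]; rfl)
      rcases i with v | e
      · rw [PresGroup.factorGen, hΦ]
        refine smul_mem_of_stabilizer hd hG (hεo v) ?_ ?_ hx
        · have : gv v ^ k ∈ MulAction.stabilizer G (v : V) := hgv v ▸ ⟨k, rfl⟩
          exact this
        · exact fun h => hk0 (hgv_dvd v k (hedge _ _ h))
      · rw [PresGroup.factorGen, hΦ]
        refine hSY.zpow_smul_mem_edgeSet hg hd hG e ?_ hx
        rintro rfl
        exact hk0 (dvd_zero _)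
    · rintro (v | e) (w | f) hne
      · rintro x ⟨-, hx⟩
        exact hSY.mem_halfTree_of_notMem hd v.2 w.2 (fun h => hne (by rw [Subtype.ext h]))
          (hε v) (hε w) (hεo v) (hεo w) hx
      · rintro x ⟨-, hx⟩ hxe
        exact hx (hSY.edgeSet_subset hg hd v.2 (hε v) (hεo v) f hxe)
      · exact hSY.edgeSet_subset hg hd w.2 (hε w) (hεo w) e
      · exact (Set.disjoint_left.1 (hSY.disjoint_edgeSet hg hd fun h => hne (by rw [h])))
    -- A vertex of `S` lies in none of the target sets, and each source set contains one.
    · have hS : ∀ s ∈ S.verts, ∀ j : terminalVertices G S ⊕ pairedEdges S Y, s ∉ (Sum.elim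
          (fun v : terminalVertices G S => {x | x ≠ (v : V) ∧ x ∉ X.halfTree d (ε v)})
          (edgeSet d g) j : Set V) := by
        rintro s hs (v | e)
        · rintro ⟨h1, h2⟩
          exact h2 (hSY.mem_halfTree_of_isTerminal hd v.2 (hε v) (hεo v) hs h1)
        · exact hSY.notMem_edgeSet hg hd e hs
      rintro (v | e)
      · exact ⟨_, hd.t_mem_halfTree (ε v), hS _ (S.t_mem (hε v))⟩
      · exact ⟨_, hSY.notMem_edgeSet hg hd e e.2.2.2, hS _ e.2.2.2⟩
  exact ⟨MulEquiv.ofBijective Φ ⟨hinj, hsurj⟩, hΦ .zero, fun v => hΦ (.vertex v),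
    fun e => hΦ (.edge e)⟩

end IsFundamentalDomain

end MGraph

/-! ### The valuation of `K∞` -/

section Valuation

variable {F : Type*} [Field F] [DecidableEq (RatFunc F)]

theorem v_algebraMap (r : RatFunc F) :
    Valued.v (algebraMap (RatFunc F) (KInf F) r) = RatFunc.inftyValuation F r :=
  letI := RatFunc.inftyValued F
  Valued.valuedCompletion_apply (K := RatFunc F) r

theorem v_unifInf : Valued.v (unifInf F) = WithZero.exp (-1 : ℤ) := by
  rw [unifInf, v_algebraMap, ← one_div]
  exact RatFunc.inftyValuation.X_inv F

theorem v_unifInf_lt : Valued.v (unifInf F) < 1 := by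
  rw [v_unifInf, ← WithZero.exp_zero, WithZero.exp_lt_exp]
  norm_num

theorem v_unifInf_zpow (n : ℤ) : Valued.v (unifInf F ^ n) = WithZero.exp (-n) := by
  rw [map_zpow₀, v_unifInf, ← WithZero.exp_zsmul]
  simp

theorem le_v_unifInf_iff {x : ℤᵐ⁰} : x ≤ Valued.v (unifInf F) ↔ x < 1 := by
  rw [v_unifInf]
  induction x using WithZero.expRecOn with
  | zero => simp
  | exp n => rw [← WithZero.exp_zero, WithZero.exp_lt_exp, WithZero.exp_le_exp]; omega

theorem exists_v_eq {a : KInf F} (ha : a ≠ 0) : ∃ n : ℤ, Valued.v a = Valued.v (unifInf F ^ n) := by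
  refine ⟨-(Valued.v a).log, ?_⟩
  rw [v_unifInf_zpow, neg_neg, WithZero.exp_log ((Valuation.ne_zero_iff _).2 ha)]

theorem one_le_v_polynomial {p : F[X]} (hp : p ≠ 0) :
    1 ≤ Valued.v (algebraMap (RatFunc F) (KInf F) (algebraMap F[X] (RatFunc F) p)) := by
  rw [v_algebraMap, RatFunc.inftyValuation_apply, RatFunc.inftyValuation.polynomial F hp,
    ← WithZero.exp_zero, WithZero.exp_le_exp]
  positivity

variable (F) in
/-- The field of constants in `K∞`. -/
def constInf : F →+* KInf F := (algebraMap (RatFunc F) (KInf F)).comp RatFunc.C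

theorem v_constInf {c : F} (hc : c ≠ 0) : Valued.v (constInf F c) = 1 := by
  rw [constInf, RingHom.comp_apply, v_algebraMap, RatFunc.inftyValuation.C F hc]

theorem v_constInf_le (c : F) : Valued.v (constInf F c) ≤ 1 := by
  rcases eq_or_ne c 0 with rfl | hc
  · simp
  · exact (v_constInf hc).le

theorem RatFunc.exists_C_inftyValuation_sub_lt (r : RatFunc F)
    (hr : RatFunc.inftyValuation F r ≤ 1) :
    ∃ c : F, RatFunc.inftyValuation F (r - RatFunc.C c) < 1 := by
  have hden := r.denom_ne_zero
  have hpoly : ∀ {p : F[X]}, p ≠ 0 → RatFunc.inftyValuation F (algebraMap F[X] (RatFunc F) p) =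
      WithZero.exp (p.natDegree : ℤ) := fun hp => RatFunc.inftyValuation.polynomial F hp
  -- The polynomial part `s` of `r` is a constant.
  set s := r.num / r.denom with hs
  have hdecomp : r - algebraMap F[X] (RatFunc F) s =
      algebraMap F[X] (RatFunc F) (r.num % r.denom) / algebraMap F[X] (RatFunc F) r.denom := by
    have h := congrArg (algebraMap F[X] (RatFunc F)) (EuclideanDomain.div_add_mod r.num r.denom)
    rw [map_add, map_mul] at h
    have h' := RatFunc.num_div_denom r
    have hd : algebraMap F[X] (RatFunc F) r.denom ≠ 0 := by simpa using hden
    rw [eq_div_iff hd, sub_mul, hs]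
    nth_rewrite 1 [← h']
    rw [div_mul_cancel₀ _ hd, ← h]
    ring
  have hlt : RatFunc.inftyValuation F (r - algebraMap F[X] (RatFunc F) s) < 1 := by
    rw [hdecomp, map_div₀, hpoly hden]
    by_cases h0 : r.num % r.denom = 0
    · rw [h0]; simp
    · rw [hpoly h0, ← WithZero.exp_sub, ← WithZero.exp_zero, WithZero.exp_lt_exp]
      have := Polynomial.natDegree_lt_natDegree h0 (Polynomial.degree_mod_lt r.num hden)
      omega
  have hsdeg : s.natDegree = 0 := by
    by_contra h
    have hs0 : s ≠ 0 := by rintro h0; rw [h0] at h; simp at h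
    have h1 : RatFunc.inftyValuation F (algebraMap F[X] (RatFunc F) s) ≤ 1 := by
      have : algebraMap F[X] (RatFunc F) s = r - (r - algebraMap F[X] (RatFunc F) s) := by ring
      rw [this]
      exact (Valuation.map_sub _ _ _).trans (max_le hr hlt.le)
    rw [hpoly hs0, ← WithZero.exp_zero, WithZero.exp_le_exp] at h1
    omega
  obtain ⟨c, hc⟩ := Polynomial.natDegree_eq_zero.1 hsdeg
  refine ⟨c, ?_⟩
  rwa [← hc, RatFunc.algebraMap_C] at hlt

/-- The residue field of `K∞` is the field of constants. -/
theorem exists_constInf_sub_lt (a : KInf F) (ha : Valued.v a ≤ 1) :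
    ∃ c : F, Valued.v (a - constInf F c) < 1 := by
  obtain ⟨r, hr⟩ : ∃ r : RatFunc F, Valued.v (a - algebraMap (RatFunc F) (KInf F) r) < 1 := by
    let := RatFunc.inftyValued F
    have hopen : IsOpen {x : KInf F | Valued.v (a - x) < 1} := by
      rw [isOpen_iff_mem_nhds]
      intro x hx
      rw [Valued.mem_nhds]
      refine ⟨1, fun y hy => ?_⟩
      have h : a - y = (a - x) - (y - x) := by ring
      change Valued.v (a - y) < 1
      rw [h]
      exact (Valuation.map_sub _ _ _).trans_lt (max_lt hx (by simpa using hy))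
    obtain ⟨r, hr⟩ := (UniformSpace.Completion.denseRange_coe (α := RatFunc F)).exists_mem_open
      hopen ⟨a, by change Valued.v (a - a) < 1; simp⟩
    exact ⟨r, hr⟩
  have hr1 : RatFunc.inftyValuation F r ≤ 1 := by
    rw [← v_algebraMap]
    have : algebraMap (RatFunc F) (KInf F) r = a - (a - algebraMap (RatFunc F) (KInf F) r) := by
      ring
    rw [this]
    exact (Valuation.map_sub _ _ _).trans (max_le ha hr.le)
  obtain ⟨c, hc⟩ := RatFunc.exists_C_inftyValuation_sub_lt r hr1
  refine ⟨c, ?_⟩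
  have : a - constInf F c = (a - algebraMap (RatFunc F) (KInf F) r) +
      algebraMap (RatFunc F) (KInf F) (r - RatFunc.C c) := by
    rw [map_sub, constInf, RingHom.comp_apply]; ring
  rw [this]
  exact Valuation.map_add_lt _ hr (by rwa [v_algebraMap])

instance : IsPrincipalIdealRing (OInf F) := by
  have hint : (Valued.v : Valuation (KInf F) ℤᵐ⁰).Integers (OInf F) :=
    Valuation.integer.integers _
  rw [hint.isPrincipalIdealRing_iff_not_denselyOrdered]
  intro h
  obtain ⟨⟨_, ⟨x, rfl⟩⟩, h1, h2⟩ := h.dense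
    (⟨Valued.v (unifInf F), Set.mem_range_self _⟩ : Set.range (Valued.v : Valuation (KInf F) ℤᵐ⁰))
    ⟨Valued.v 1, Set.mem_range_self _⟩ (Subtype.mk_lt_mk.2 (by rw [map_one]; exact v_unifInf_lt))
  have h1' : Valued.v (unifInf F) < Valued.v x := h1
  have h2' : Valued.v x < Valued.v (1 : KInf F) := h2
  rw [map_one] at h2'
  exact absurd h1' (not_lt.2 (le_v_unifInf_iff.2 h2'))

end Valuation

/-! ### Lattices and matrices -/

section Lattices

variable {F : Type*} [Field F] [DecidableEq (RatFunc F)]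

theorem span_basisFun_eq {ι R : Type*} [Fintype ι] [DecidableEq ι] [CommRing R]
    (O : Subring R) (w : ι → R) :
    w ∈ Submodule.span O (Set.range (Pi.basisFun R ι)) ↔ ∀ i, w i ∈ O := by
  rw [Submodule.mem_span_range_iff_exists_fun]
  constructor
  · rintro ⟨c, rfl⟩ i
    have : (∑ j, c j • Pi.basisFun R ι j) i = (c i : R) := by
      simp [Finset.sum_apply, Pi.basisFun_apply, Pi.single_apply, Subring.smul_def]
    rw [this]
    exact (c i).2
  · intro h
    refine ⟨fun i => ⟨w i, h i⟩, funext fun i => ?_⟩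
    simp [Finset.sum_apply, Pi.basisFun_apply, Pi.single_apply, Subring.smul_def]

variable (F) in
/-- The standard lattice `O∞²`. -/
def stdLattice : LatticeInf F :=
  ⟨Submodule.span (OInf F) (Set.range (Pi.basisFun (KInf F) (Fin 2))),
    Submodule.fg_span (Set.finite_range _), by
      rw [Submodule.span_span_of_tower, Module.Basis.span_eq]⟩

variable (F) in
/-- The standard vertex `[O∞²]`. -/
def stdVertex : BTVertex F := (stdLattice F).toVertex

theorem mem_stdLattice {w : Fin 2 → KInf F} :
    w ∈ (stdLattice F).1 ↔ ∀ i, Valued.v (w i) ≤ 1 :=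
  span_basisFun_eq (OInf F) w

theorem mem_map_stdLattice {g : GL (Fin 2) (KInf F)} {w : Fin 2 → KInf F} :
    w ∈ ((stdLattice F).map g).1 ↔ ∀ i, Valued.v (Matrix.mulVec (g⁻¹).val w i) ≤ 1 := by
  rw [LatticeInf.mem_map]
  constructor
  · rintro ⟨y, hy, rfl⟩
    rw [Matrix.mulVec_mulVec, Units.inv_mul, Matrix.one_mulVec]
    exact mem_stdLattice.1 hy
  · intro h
    refine ⟨_, mem_stdLattice.2 h, ?_⟩
    rw [Matrix.mulVec_mulVec, Units.mul_inv, Matrix.one_mulVec]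

theorem mem_smul_lattice {c : KInf F} (hc : c ≠ 0)
    {L : Submodule (OInf F) (Fin 2 → KInf F)} {w : Fin 2 → KInf F} :
    w ∈ c • L ↔ c⁻¹ • w ∈ L := by
  rw [Submodule.mem_smul_pointwise_iff_exists]
  constructor
  · rintro ⟨y, hy, rfl⟩
    rwa [inv_smul_smul₀ hc]
  · exact fun h => ⟨_, h, smul_inv_smul₀ hc w⟩

/-- Every lattice has a basis. -/
theorem exists_map_stdLattice (L : LatticeInf F) :
    ∃ g : GL (Fin 2) (KInf F), (stdLattice F).map g = L := by
  have := L.2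
  have := Submodule.IsLattice.free (K := KInf F) L.1
  have hrank : Module.finrank (OInf F) L.1 = 2 := by
    rw [Submodule.IsLattice.finrank_of_pi (K := KInf F), Fintype.card_fin]
  let b : Module.Basis (Fin 2) (OInf F) L.1 := Module.finBasisOfFinrankEq _ _ hrank
  let b' := b.extendOfIsLattice (KInf F)
  have hb' : ∀ i, b' i = (b i).val := fun i => b.extendOfIsLattice_apply (KInf F) i
  let := (Pi.basisFun (KInf F) (Fin 2)).invertibleToMatrix b'
  refine ⟨unitOfInvertible ((Pi.basisFun (KInf F) (Fin 2)).toMatrix b'), Subtype.ext ?_⟩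
  have hmul : ∀ y : Fin 2 → KInf F, Matrix.mulVec
      (unitOfInvertible ((Pi.basisFun (KInf F) (Fin 2)).toMatrix b')).val y =
      ∑ j, y j • (b j).val := by
    intro y
    ext i
    simp [Matrix.mulVec, dotProduct, Module.Basis.toMatrix_apply, hb', mul_comm]
  ext w
  rw [LatticeInf.mem_map]
  constructor
  · rintro ⟨y, hy, rfl⟩
    rw [hmul]
    exact Submodule.sum_mem _ fun j _ =>
      L.1.smul_mem (⟨y j, mem_stdLattice.1 hy j⟩ : OInf F) (b j).2
  · intro hw
    refine ⟨fun j => (b.repr ⟨w, hw⟩ j : KInf F), mem_stdLattice.2 fun j => (b.repr _ j).2, ?_⟩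
    rw [hmul]
    have := congrArg (Subtype.val) (b.sum_repr ⟨w, hw⟩)
    rw [AddSubmonoidClass.coe_finsetSum] at this
    exact this

theorem exists_smul_stdVertex (x : BTVertex F) :
    ∃ g : GL (Fin 2) (KInf F), g • stdVertex F = x := by
  induction x using Quotient.inductionOn with | _ L =>
  obtain ⟨g, rfl⟩ := exists_map_stdLattice L
  exact ⟨g, rfl⟩

theorem v_mulVec_le {A : Matrix (Fin 2) (Fin 2) (KInf F)} {w : Fin 2 → KInf F} {r s : ℤᵐ⁰}
    (hA : ∀ i j, Valued.v (A i j) ≤ r) (hw : ∀ i, Valued.v (w i) ≤ s) (i : Fin 2) :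
    Valued.v (Matrix.mulVec A w i) ≤ r * s := by
  rw [Matrix.mulVec, dotProduct]
  refine Valuation.map_sum_le _ fun j _ => ?_
  rw [map_mul]
  exact mul_le_mul' (hA i j) (hw j)

theorem v_det_le {A : Matrix (Fin 2) (Fin 2) (KInf F)} {r : ℤᵐ⁰}
    (hA : ∀ i j, Valued.v (A i j) ≤ r) : Valued.v A.det ≤ r ^ 2 := by
  rw [Matrix.det_fin_two, sq]
  refine (Valuation.map_sub _ _ _).trans (max_le ?_ ?_)
  all_goals
    rw [map_mul]
    exact mul_le_mul' (hA _ _) (hA _ _)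

/-- The stabilizer of the standard vertex is `K∞ˣ GL₂(O∞)`. -/
theorem smul_stdVertex_iff {g : GL (Fin 2) (KInf F)} :
    g • stdVertex F = stdVertex F ↔
      ∃ c : KInf F, c ≠ 0 ∧ (∀ i j, Valued.v (g.val i j) ≤ Valued.v c) ∧
      Valued.v g.val.det = Valued.v c ^ 2 := by
  constructor
  · intro h
    obtain ⟨c, hc⟩ := Quotient.exact h.symm
    change ((stdLattice F).map g).1 = (c : KInf F) • (stdLattice F).1 at hc
    have hc0 : Valued.v (c : KInf F) ≠ 0 := (Valuation.ne_zero_iff _).2 c.ne_zero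
    have h1 : ∀ i j, Valued.v (g.val i j) ≤ Valued.v (c : KInf F) := by
      intro i j
      have : Matrix.mulVec g.val (Pi.single j 1) ∈ ((stdLattice F).map g).1 := by
        refine ⟨_, mem_stdLattice.2 fun i => ?_, rfl⟩
        rcases eq_or_ne i j with rfl | hij
        · simp
        · simp [hij]
      rw [hc, mem_smul_lattice c.ne_zero, mem_stdLattice] at this
      have := this i
      rwa [Matrix.mulVec_single_one, Pi.smul_apply, smul_eq_mul, map_mul, map_inv₀,
        inv_mul_le_one₀ (zero_lt_iff.2 hc0)] at this
    have h2 : ∀ i j, Valued.v ((g⁻¹).val i j) ≤ (Valued.v (c : KInf F))⁻¹ := by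
      intro i j
      have : (c : KInf F) • Pi.single j 1 ∈ ((stdLattice F).map g).1 := by
        rw [hc, mem_smul_lattice c.ne_zero, inv_smul_smul₀ c.ne_zero, mem_stdLattice]
        intro i
        rcases eq_or_ne i j with rfl | hij
        · simp
        · simp [hij]
      rw [mem_map_stdLattice] at this
      have := this i
      rwa [Matrix.mulVec_smul, Matrix.mulVec_single_one, Pi.smul_apply, smul_eq_mul, map_mul,
        mul_comm, ← le_mul_inv_iff₀ (zero_lt_iff.2 hc0), one_mul] at this
    refine ⟨c, c.ne_zero, h1, le_antisymm (v_det_le h1) ?_⟩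
    have h3 := v_det_le h2
    have h4 : Valued.v g.val.det * Valued.v (g⁻¹).val.det = 1 := by
      rw [← map_mul, ← Matrix.det_mul, Units.mul_inv, Matrix.det_one, map_one]
    have hd0 : Valued.v g.val.det ≠ 0 := left_ne_zero_of_mul_eq_one h4
    rw [eq_inv_of_mul_eq_one_right h4, inv_pow,
      inv_le_inv₀ (zero_lt_iff.2 hd0) (zero_lt_iff.2 (pow_ne_zero _ hc0))] at h3
    exact h3
  · rintro ⟨c, hc, h1, h2⟩
    have hc0 : Valued.v c ≠ 0 := (Valuation.ne_zero_iff _).2 hc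
    have hdet : g.val.det ≠ 0 := by
      rw [← Valuation.ne_zero_iff Valued.v, h2]
      exact pow_ne_zero _ hc0
    have h3 : ∀ i j, Valued.v ((g⁻¹).val i j) ≤ (Valued.v c)⁻¹ := by
      have hinv : (g⁻¹).val = (g.val.det)⁻¹ • g.val.adjugate := by
        rw [Matrix.coe_units_inv, Matrix.inv_def, Ring.inverse_eq_inv']
      have hadj : ∀ i j, Valued.v (g.val.adjugate i j) ≤ Valued.v c := by
        rw [Matrix.adjugate_fin_two]
        intro i j
        fin_cases i <;> fin_cases j <;> simp [h1, Valuation.map_neg]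
      intro i j
      rw [hinv, Matrix.smul_apply, smul_eq_mul, map_mul, map_inv₀, h2]
      refine (mul_le_mul_right (hadj i j) _).trans (le_of_eq ?_)
      field_simp
    refine (Quotient.sound (s := homothety F) (a := stdLattice F) (b := (stdLattice F).map g)
      ⟨Units.mk0 c hc, ?_⟩).symm
    ext w
    rw [Units.val_mk0, mem_smul_lattice hc, mem_map_stdLattice, mem_stdLattice]
    constructor
    · intro h i
      have := v_mulVec_le h1 h i
      rw [Matrix.mulVec_mulVec, Units.mul_inv, Matrix.one_mulVec, mul_one] at this
      rwa [Pi.smul_apply, smul_eq_mul, map_mul, map_inv₀, inv_mul_le_one₀ (zero_lt_iff.2 hc0)]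
    · intro h i
      have h' : ∀ i, Valued.v (w i) ≤ Valued.v c := by
        intro i
        have := h i
        rwa [Pi.smul_apply, smul_eq_mul, map_mul, map_inv₀, inv_mul_le_one₀ (zero_lt_iff.2 hc0)]
          at this
      refine (v_mulVec_le h3 h' i).trans (le_of_eq (inv_mul_cancel₀ hc0))

end Lattices

/-! ### The Bruhat-Tits tree is a tree -/

section Tree

variable {F : Type*} [Field F] [DecidableEq (RatFunc F)]

/-- An explicit element of `GL₂(K∞)`. -/
def glMk (p q r s : KInf F) (h : p * s - q * r ≠ 0) : GL (Fin 2) (KInf F) :=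
  Matrix.GeneralLinearGroup.mkOfDetNeZero !![p, q; r, s] (by rwa [Matrix.det_fin_two_of])

@[simp]
theorem glMk_val (p q r s : KInf F) (h : p * s - q * r ≠ 0) :
    (glMk p q r s h).val = !![p, q; r, s] := rfl

theorem exists_glMk (g : GL (Fin 2) (KInf F)) : ∃ p q r s h, g = glMk p q r s h := by
  refine ⟨g.val 0 0, g.val 0 1, g.val 1 0, g.val 1 1, ?_, ?_⟩
  · rw [← Matrix.det_fin_two]
    exact ((Matrix.isUnit_iff_isUnit_det _).1 g.isUnit).ne_zero
  · exact Units.ext (Matrix.eta_fin_two _)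

variable (F) in
/-- The matrix `diag(1, π ^ n)`. -/
def diagInf (n : ℤ) : GL (Fin 2) (KInf F) :=
  glMk 1 0 0 (unifInf F ^ n) (by simpa using zpow_ne_zero n unifInf_ne_zero)

@[simp]
theorem diagInf_val (n : ℤ) : (diagInf F n).val = !![1, 0; 0, unifInf F ^ n] := rfl

theorem diagInf_mul (m n : ℤ) : diagInf F m * diagInf F n = diagInf F (m + n) := by
  refine Units.ext ?_
  simp [zpow_add₀ unifInf_ne_zero]

theorem diagInf_zero : diagInf F 0 = 1 := by
  refine Units.ext ?_
  simp [Matrix.one_fin_two]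

theorem diagInf_inv (n : ℤ) : (diagInf F n)⁻¹ = diagInf F (-n) := by
  rw [inv_eq_iff_mul_eq_one, diagInf_mul, add_neg_cancel, diagInf_zero]

variable (F) in
/-- The vertex `[O∞ ⊕ π ^ n O∞]`. -/
def diagVertex (n : ℤ) : BTVertex F := diagInf F n • stdVertex F

theorem diagVertex_zero : diagVertex F 0 = stdVertex F := by
  rw [diagVertex, diagInf_zero, one_smul]

theorem diagInf_smul_diagVertex (m n : ℤ) :
    diagInf F m • diagVertex F n = diagVertex F (m + n) := by
  rw [diagVertex, diagVertex, ← mul_smul, diagInf_mul]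

theorem glMk_smul_stdVertex_iff {p q r s : KInf F} {h : p * s - q * r ≠ 0} :
    glMk p q r s h • stdVertex F = stdVertex F ↔ ∃ c : KInf F, c ≠ 0 ∧
      (Valued.v p ≤ Valued.v c ∧ Valued.v q ≤ Valued.v c ∧ Valued.v r ≤ Valued.v c ∧
        Valued.v s ≤ Valued.v c) ∧ Valued.v (p * s - q * r) = Valued.v c ^ 2 := by
  rw [smul_stdVertex_iff]
  simp [Fin.forall_fin_two, Matrix.det_fin_two_of, and_assoc]

theorem glMk_smul_diagVertex_iff {p q r s : KInf F} {h : p * s - q * r ≠ 0} {m n : ℤ} :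
    glMk p q r s h • diagVertex F n = diagVertex F m ↔ ∃ c : KInf F, c ≠ 0 ∧
      (Valued.v p ≤ Valued.v c ∧ Valued.v (q * unifInf F ^ n) ≤ Valued.v c ∧
        Valued.v (unifInf F ^ (-m) * r) ≤ Valued.v c ∧
        Valued.v (unifInf F ^ (n - m) * s) ≤ Valued.v c) ∧
        Valued.v (unifInf F ^ (n - m) * (p * s - q * r)) = Valued.v c ^ 2 := by
  have hπ := unifInf_ne_zero (F := F)
  have h' : p * (unifInf F ^ (n - m) * s) - (q * unifInf F ^ n) * (unifInf F ^ (-m) * r) =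
      unifInf F ^ (n - m) * (p * s - q * r) := by
    rw [zpow_sub₀ hπ, zpow_neg]; ring
  have h'' : p * (unifInf F ^ (n - m) * s) - (q * unifInf F ^ n) * (unifInf F ^ (-m) * r) ≠ 0 := by
    rw [h']; exact mul_ne_zero (zpow_ne_zero _ hπ) h
  have key : diagInf F (-m) * glMk p q r s h * diagInf F n = glMk _ _ _ _ h'' := by
    refine Units.ext ?_
    simp only [Units.val_mul, diagInf_val, glMk_val, Matrix.mul_fin_two]
    have : unifInf F ^ (n - m) = unifInf F ^ (-m) * unifInf F ^ n := by
      rw [← zpow_add₀ hπ]; congr 1; ring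
    rw [this]
    simp [mul_comm, mul_left_comm]
  rw [← h', ← glMk_smul_stdVertex_iff (h := h''), ← key, mul_smul, mul_smul, ← diagInf_inv,
    inv_smul_eq_iff]
  rfl

/-- A matrix whose determinant is as large as its entries allow has an entry of the largest
valuation in its first column. -/
theorem v_eq_or_v_eq {p q r s : KInf F} {γ : ℤᵐ⁰} (hγ : γ ≠ 0) (hp : Valued.v p ≤ γ)
    (hq : Valued.v q ≤ γ) (hr : Valued.v r ≤ γ) (hs : Valued.v s ≤ γ)
    (h : Valued.v (p * s - q * r) = γ ^ 2) : Valued.v p = γ ∨ Valued.v r = γ := by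
  by_contra! hcon
  have hp' := lt_of_le_of_ne hp hcon.1
  have hr' := lt_of_le_of_ne hr hcon.2
  have hpos := zero_lt_iff.2 hγ
  refine absurd h (ne_of_lt ((Valuation.map_sub _ _ _).trans_lt (max_lt ?_ ?_)))
  · rw [map_mul, sq]
    exact (mul_le_mul_right hs _).trans_lt (mul_lt_mul_of_pos_right hp' hpos)
  · rw [map_mul, sq]
    exact (mul_le_mul_left hq _).trans_lt (mul_lt_mul_of_pos_left hr' hpos)

variable (F) in
/-- The permutation matrix exchanging the two coordinates. -/
def swapInf : GL (Fin 2) (KInf F) := glMk 0 1 1 0 (by simp)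

theorem swapInf_smul_stdVertex : swapInf F • stdVertex F = stdVertex F :=
  glMk_smul_stdVertex_iff.2 ⟨1, one_ne_zero, by simp⟩

theorem swapInf_mul_self : swapInf F * swapInf F = 1 := by
  refine Units.ext ?_
  rw [Units.val_mul, swapInf, glMk_val, Units.val_one, Matrix.one_fin_two, Matrix.mul_fin_two]
  simp

/-- The Cartan decomposition: up to the stabilizer of the standard vertex, every vertex is one of
the `[O∞ ⊕ π ^ n O∞]` with `n ≥ 0`. -/
theorem exists_smul_diagVertex (g : GL (Fin 2) (KInf F)) :
    ∃ (k : GL (Fin 2) (KInf F)) (n : ℕ), k • stdVertex F = stdVertex F ∧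
      k • diagVertex F n = g • stdVertex F := by
  -- Permuting rows or columns does not matter, so the largest entry may be moved to any place.
  have hrow : ∀ g : GL (Fin 2) (KInf F), (∃ (k : GL (Fin 2) (KInf F)) (n : ℕ),
      k • stdVertex F = stdVertex F ∧ k • diagVertex F n = (swapInf F * g) • stdVertex F) →
      ∃ (k : GL (Fin 2) (KInf F)) (n : ℕ), k • stdVertex F = stdVertex F ∧
        k • diagVertex F n = g • stdVertex F := by
    rintro g ⟨k, n, h1, h2⟩
    refine ⟨swapInf F * k, n, by rw [mul_smul, h1, swapInf_smul_stdVertex], ?_⟩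
    rw [mul_smul, h2, smul_smul, ← mul_assoc, swapInf_mul_self, one_mul]
  have hcol : ∀ g : GL (Fin 2) (KInf F), (∃ (k : GL (Fin 2) (KInf F)) (n : ℕ),
      k • stdVertex F = stdVertex F ∧ k • diagVertex F n = (g * swapInf F) • stdVertex F) →
      ∃ (k : GL (Fin 2) (KInf F)) (n : ℕ), k • stdVertex F = stdVertex F ∧
        k • diagVertex F n = g • stdVertex F := by
    rintro g ⟨k, n, h1, h2⟩
    exact ⟨k, n, h1, by rw [h2, mul_smul, swapInf_smul_stdVertex]⟩
  -- The case that the upper left entry is the largest one.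
  have main : ∀ (p q r s : KInf F) (h : p * s - q * r ≠ 0), Valued.v q ≤ Valued.v p →
      Valued.v r ≤ Valued.v p → Valued.v s ≤ Valued.v p →
      ∃ (k : GL (Fin 2) (KInf F)) (n : ℕ), k • stdVertex F = stdVertex F ∧
        k • diagVertex F n = glMk p q r s h • stdVertex F := by
    intro p q r s h hq hr hs
    have hp : p ≠ 0 := by
      rintro rfl
      have hq0 : q = 0 := by simpa using hq
      exact h (by simp [hq0])
    have hvp : Valued.v p ≠ 0 := (Valuation.ne_zero_iff _).2 hp
    -- Clearing the lower left entry by a row operation over `O∞` leaves `!![p, q; 0, δ]`.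
    set δ := (p * s - q * r) / p with hδ
    have hpδ : p * δ = p * s - q * r := by rw [hδ]; field_simp
    have hδ0 : δ ≠ 0 := div_ne_zero h hp
    have hvδ : Valued.v δ ≤ Valued.v p := by
      rw [hδ, map_div₀]
      refine div_le_of_le_mul₀ zero_le zero_le ?_
      refine (Valuation.map_sub _ _ _).trans (max_le ?_ ?_)
      · rw [map_mul, mul_comm]; exact mul_le_mul_left hs _
      · rw [map_mul]; exact mul_le_mul' hq hr
    obtain ⟨n, hn⟩ := exists_v_eq (div_ne_zero hδ0 hp)
    have hn0 : 0 ≤ n := by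
      have h1 : Valued.v (δ / p) ≤ 1 := by
        rw [map_div₀]; exact div_le_one_of_le₀ hvδ zero_le
      rw [hn, v_unifInf_zpow, ← WithZero.exp_zero, WithZero.exp_le_exp] at h1
      omega
    obtain ⟨n, rfl⟩ := Int.eq_ofNat_of_zero_le hn0
    have hvδp : Valued.v (unifInf F ^ (-(n : ℤ)) * δ) = Valued.v p := by
      rw [map_mul, zpow_neg, map_inv₀, ← hn, map_div₀]
      have : Valued.v δ ≠ 0 := (Valuation.ne_zero_iff _).2 hδ0
      field_simp
    have hfac : glMk p q r s h = glMk 1 0 (r / p) 1 (by simp) *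
        glMk p q 0 δ (by simpa using mul_ne_zero hp hδ0) := by
      refine Units.ext ?_
      simp only [Units.val_mul, glMk_val, Matrix.mul_fin_two]
      have h1 : r = r / p * p + 1 * 0 := by field_simp; ring
      have h2 : s = r / p * q + 1 * δ := by rw [hδ]; field_simp; ring
      rw [← h1, ← h2]
      simp
    refine ⟨glMk 1 0 (r / p) 1 (by simp), n, ?_, ?_⟩
    · refine glMk_smul_stdVertex_iff.2 ⟨1, one_ne_zero, ?_⟩
      simpa using div_le_one_of_le₀ hr zero_le
    · rw [hfac, mul_smul, smul_left_cancel_iff, ← diagVertex_zero, eq_comm,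
        glMk_smul_diagVertex_iff]
      refine ⟨p, hp, ⟨le_rfl, by simpa using hq, by simp, by rw [zero_sub, hvδp]⟩, ?_⟩
      rw [zero_sub, mul_zero, sub_zero, mul_left_comm, map_mul, hvδp, sq]
  obtain ⟨p, q, r, s, h, rfl⟩ := exists_glMk g
  have hrow' : swapInf F * glMk p q r s h = glMk r s p q (by
      intro h0; apply h; linear_combination -h0) := by
    refine Units.ext ?_
    simp [swapInf]
  have hcol' : glMk p q r s h * swapInf F = glMk q p s r (by
      intro h0; apply h; linear_combination -h0) := by
    refine Units.ext ?_
    simp [swapInf]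
  have hrowcol' : swapInf F * glMk p q r s h * swapInf F = glMk s r q p (by
      intro h0; apply h; linear_combination h0) := by
    refine Units.ext ?_
    simp [swapInf]
  rcases le_total (Valued.v p) (Valued.v q) with h1 | h1 <;>
  rcases le_total (Valued.v r) (Valued.v s) with h2 | h2
  · rcases le_total (Valued.v q) (Valued.v s) with h3 | h3
    · apply hrow; apply hcol; rw [hrowcol']
      exact main _ _ _ _ _ h2 h3 (h1.trans h3)
    · apply hcol; rw [hcol']
      exact main _ _ _ _ _ h1 h3 (h2.trans h3)
  · rcases le_total (Valued.v q) (Valued.v r) with h3 | h3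
    · apply hrow; rw [hrow']
      exact main _ _ _ _ _ h2 (h1.trans h3) h3
    · apply hcol; rw [hcol']
      exact main _ _ _ _ _ h1 (h2.trans h3) h3
  · rcases le_total (Valued.v p) (Valued.v s) with h3 | h3
    · apply hrow; apply hcol; rw [hrowcol']
      exact main _ _ _ _ _ h2 (h1.trans h3) h3
    · exact main _ _ _ _ _ h1 (h2.trans h3) h3
  · rcases le_total (Valued.v p) (Valued.v r) with h3 | h3
    · apply hrow; rw [hrow']
      exact main _ _ _ _ _ h2 h3 (h1.trans h3)
    · exact main _ _ _ _ _ h1 h3 (h2.trans h3)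

/-- `L` consists of the vectors whose coordinates are bounded by `exp a` and `exp b`. -/
def IsBox (L : Submodule (OInf F) (Fin 2 → KInf F)) (a b : ℤ) : Prop :=
  ∀ w, w ∈ L ↔ Valued.v (w 0) ≤ WithZero.exp a ∧ Valued.v (w 1) ≤ WithZero.exp b

theorem IsBox.le_iff {L L' : Submodule (OInf F) (Fin 2 → KInf F)} {a b a' b' : ℤ}
    (h : IsBox L a b) (h' : IsBox L' a' b') : L ≤ L' ↔ a ≤ a' ∧ b ≤ b' := by
  constructor
  · intro hle
    have h1 := (h' ![unifInf F ^ (-a), 0]).1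
      (hle ((h _).2 (by simp [-map_zpow₀, v_unifInf_zpow, -zpow_neg])))
    have h2 := (h' ![0, unifInf F ^ (-b)]).1
      (hle ((h _).2 (by simp [-map_zpow₀, v_unifInf_zpow, -zpow_neg])))
    simp [-map_zpow₀, v_unifInf_zpow, -zpow_neg] at h1 h2
    exact ⟨h1, h2⟩
  · rintro ⟨h1, h2⟩ w hw
    have := (h w).1 hw
    exact (h' w).2 ⟨this.1.trans (WithZero.exp_le_exp.2 h1),
      this.2.trans (WithZero.exp_le_exp.2 h2)⟩

theorem isBox_stdLattice : IsBox (stdLattice F).1 0 0 := by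
  intro w
  rw [mem_stdLattice, Fin.forall_fin_two, WithZero.exp_zero]

theorem v_unifInf_zpow_mul_le_iff {n b : ℤ} {a : KInf F} :
    Valued.v (unifInf F ^ n * a) ≤ WithZero.exp b ↔ Valued.v a ≤ WithZero.exp (b + n) := by
  rw [map_mul, v_unifInf_zpow, ← mul_le_mul_iff_right₀ (a := WithZero.exp n)
    (WithZero.exp_pos), ← mul_assoc, ← WithZero.exp_add, ← WithZero.exp_add, add_neg_cancel,
    WithZero.exp_zero, one_mul, add_comm]

theorem isBox_map_diagInf (n : ℤ) : IsBox ((stdLattice F).map (diagInf F n)).1 0 (-n) := by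
  intro w
  rw [mem_map_stdLattice, diagInf_inv, Fin.forall_fin_two, diagInf_val]
  simp only [Matrix.mulVec, dotProduct, Fin.sum_univ_two]
  simp only [Matrix.of_apply, Matrix.cons_val_zero, Matrix.cons_val_one, one_mul,
    zero_mul, add_zero, zero_add]
  rw [← WithZero.exp_zero, v_unifInf_zpow_mul_le_iff, zero_add]

theorem IsBox.smul {L : Submodule (OInf F) (Fin 2 → KInf F)} {a b n : ℤ} {c : KInf F}
    (h : IsBox L a b) (hc : c ≠ 0) (hn : Valued.v c = Valued.v (unifInf F ^ n)) :
    IsBox (c • L) (a - n) (b - n) := by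
  intro w
  have h' : ∀ (x : KInf F) (b : ℤ), Valued.v (c⁻¹ * x) ≤ WithZero.exp b ↔
      Valued.v x ≤ WithZero.exp (b - n) := by
    intro x b
    rw [map_mul, map_inv₀, hn, ← map_inv₀, ← zpow_neg, ← map_mul, v_unifInf_zpow_mul_le_iff,
      sub_eq_add_neg]
  rw [mem_smul_lattice hc, h, Pi.smul_apply, Pi.smul_apply, smul_eq_mul, smul_eq_mul, h', h']

theorem btAdj_stdVertex_diagVertex_iff {n : ℕ} : BTAdj (stdVertex F) (diagVertex F n) ↔ n = 1 := by
  constructor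
  · rintro ⟨L, L', h, h', h1, h2⟩
    -- Comparing exponents: `πL ⊊ L' ⊊ L` with `L`, `L'` of exponents `(-a, -a)`, `(-a', -n - a')`.
    obtain ⟨c, hc⟩ := Quotient.exact h.symm
    obtain ⟨c', hc'⟩ := Quotient.exact h'.symm
    obtain ⟨a, ha⟩ := exists_v_eq c.ne_zero
    obtain ⟨a', ha'⟩ := exists_v_eq c'.ne_zero
    have hL : IsBox L.1 _ _ := hc ▸ isBox_stdLattice.smul c.ne_zero ha
    have hL' : IsBox L'.1 _ _ := hc' ▸ (isBox_map_diagInf n).smul c'.ne_zero ha'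
    have hπ := hL.smul unifInf_ne_zero (n := 1) (by rw [zpow_one])
    rw [lt_iff_le_not_ge, hπ.le_iff hL', hL'.le_iff hπ] at h1
    rw [lt_iff_le_not_ge, hL.le_iff hL', hL'.le_iff hL] at h2
    omega
  · rintro rfl
    have hπ := isBox_stdLattice.smul (F := F) unifInf_ne_zero (n := 1) (by rw [zpow_one])
    have hL' := isBox_map_diagInf (F := F) 1
    refine ⟨stdLattice F, (stdLattice F).map (diagInf F 1), rfl, rfl, ?_, ?_⟩
    · rw [lt_iff_le_not_ge, hπ.le_iff hL', hL'.le_iff hπ]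
      omega
    · rw [lt_iff_le_not_ge, isBox_stdLattice.le_iff hL', hL'.le_iff isBox_stdLattice]
      omega

theorem exists_smul_pair (x y : BTVertex F) :
    ∃ (n : ℕ) (g : GL (Fin 2) (KInf F)), g • stdVertex F = x ∧ g • diagVertex F n = y := by
  obtain ⟨g, rfl⟩ := exists_smul_stdVertex x
  obtain ⟨h, rfl⟩ := exists_smul_stdVertex y
  obtain ⟨k, n, hk, hkn⟩ := exists_smul_diagVertex (g⁻¹ * h)
  exact ⟨n, g * k, by rw [mul_smul, hk], by rw [mul_smul, hkn, mul_smul, smul_inv_smul]⟩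

theorem btAdj_iff {x y : BTVertex F} : BTAdj x y ↔
    ∃ g : GL (Fin 2) (KInf F), g • stdVertex F = x ∧ g • diagVertex F 1 = y := by
  constructor
  · intro h
    obtain ⟨n, g, rfl, rfl⟩ := exists_smul_pair x y
    have := h.smul g⁻¹
    rw [inv_smul_smul, inv_smul_smul, btAdj_stdVertex_diagVertex_iff] at this
    subst this
    exact ⟨g, rfl, rfl⟩
  · rintro ⟨g, rfl, rfl⟩
    exact (btAdj_stdVertex_diagVertex_iff.2 (rfl : 1 = 1)).smul g

theorem btAdj_smul_diagVertex_one (g : GL (Fin 2) (KInf F)) :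
    BTAdj (g • stdVertex F) (g • diagVertex F 1) :=
  btAdj_iff.2 ⟨g, rfl, rfl⟩

/-- The number `n` in the Cartan decomposition is unique: comparing valuations of determinants,
using that the first column of `g` has an entry of the largest valuation. -/
theorem le_of_smul_diagVertex {g : GL (Fin 2) (KInf F)} {n m : ℕ}
    (h : g • stdVertex F = stdVertex F) (hnm : g • diagVertex F n = diagVertex F m) : n ≤ m := by
  obtain ⟨p, q, r, s, hdet, rfl⟩ := exists_glMk g
  obtain ⟨c, hc, ⟨h1, h2, h3, h4⟩, h5⟩ := glMk_smul_stdVertex_iff.1 h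
  obtain ⟨c', hc', ⟨h1', h2', h3', h4'⟩, h5'⟩ := glMk_smul_diagVertex_iff.1 hnm
  have hvc : Valued.v c ≠ 0 := (Valuation.ne_zero_iff _).2 hc
  have hcc' : Valued.v c ≤ Valued.v c' := by
    rcases v_eq_or_v_eq hvc h1 h2 h3 h4 h5 with h | h
    · exact h ▸ h1'
    · rw [← h]
      refine le_trans ?_ h3'
      rw [map_mul, v_unifInf_zpow]
      refine le_mul_of_one_le_left' ?_
      rw [← WithZero.exp_zero, WithZero.exp_le_exp]
      omega
  rw [map_mul, h5, v_unifInf_zpow] at h5'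
  have h6 : Valued.v c ^ 2 ≤ WithZero.exp (-((n : ℤ) - m)) * Valued.v c ^ 2 := by
    rw [h5']
    exact pow_le_pow_left' hcc' 2
  have h7 : (1 : ℤᵐ⁰) ≤ WithZero.exp (-((n : ℤ) - m)) :=
    (le_mul_iff_one_le_left (zero_lt_iff.2 (pow_ne_zero 2 hvc))).1 h6
  rw [← WithZero.exp_zero, WithZero.exp_le_exp] at h7
  omega

/-- The distance of two vertices: the pair `(x, y)` is equivalent to
`([O∞ ⊕ O∞], [O∞ ⊕ π ^ n O∞])` for exactly one `n ≥ 0`. -/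
def btDist (x y : BTVertex F) : ℕ := (exists_smul_pair x y).choose

theorem btDist_smul_diagVertex (g : GL (Fin 2) (KInf F)) (n : ℕ) :
    btDist (g • stdVertex F) (g • diagVertex F n) = n := by
  obtain ⟨h, h1, h2⟩ := (exists_smul_pair (g • stdVertex F) (g • diagVertex F n)).choose_spec
  change h • diagVertex F (btDist _ _ : ℕ) = _ at h2
  refine le_antisymm (le_of_smul_diagVertex (g := g⁻¹ * h) ?_ ?_)
    (le_of_smul_diagVertex (g := h⁻¹ * g) ?_ ?_)
  · rw [mul_smul, h1, inv_smul_smul]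
  · rw [mul_smul, h2, inv_smul_smul]
  · rw [mul_smul, ← h1, inv_smul_smul]
  · rw [mul_smul, inv_smul_eq_iff, h2]

theorem btDist_smul (γ : GL (Fin 2) (KInf F)) (x y : BTVertex F) :
    btDist (γ • x) (γ • y) = btDist x y := by
  obtain ⟨n, g, rfl, rfl⟩ := exists_smul_pair x y
  rw [btDist_smul_diagVertex, ← mul_smul, ← mul_smul, btDist_smul_diagVertex]

theorem btDist_comm (x y : BTVertex F) : btDist x y = btDist y x := by
  obtain ⟨n, g, rfl, rfl⟩ := exists_smul_pair x y
  rw [btDist_smul_diagVertex]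
  -- The involution exchanging the two ends of the standard segment of length `n`.
  have h1 : (diagInf F n * swapInf F) • stdVertex F = diagVertex F n := by
    rw [mul_smul, swapInf_smul_stdVertex]; rfl
  have h2 : (diagInf F n * swapInf F) • diagVertex F n = stdVertex F := by
    have hdet : (0 : KInf F) * 0 - 1 * unifInf F ^ (n : ℤ) ≠ 0 := by
      simpa using zpow_ne_zero (n : ℤ) (unifInf_ne_zero (F := F))
    have : diagInf F n * swapInf F = glMk 0 1 (unifInf F ^ (n : ℤ)) 0 hdet := by
      refine Units.ext ?_
      simp [swapInf]
    rw [this, ← diagVertex_zero, glMk_smul_diagVertex_iff]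
    refine ⟨unifInf F ^ (n : ℤ), zpow_ne_zero _ unifInf_ne_zero, ?_⟩
    simp [sq]
  have := btDist_smul_diagVertex (g * (diagInf F n * swapInf F)) n
  rw [mul_smul g, mul_smul g, h1, h2] at this
  exact this.symm

/-- The neighbours of the standard vertex: `[O∞ ⊕ π O∞]` and those equivalent to
`[O∞ ⊕ π⁻¹ O∞]` under an element fixing all the vertices `[O∞ ⊕ π ^ n O∞]`, `n ≥ 0`. -/
theorem smul_diagVertex_one {h : GL (Fin 2) (KInf F)} (hh : h • stdVertex F = stdVertex F) :
    h • diagVertex F 1 = diagVertex F 1 ∨ ∃ k : GL (Fin 2) (KInf F),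
      (∀ n : ℕ, k • diagVertex F n = diagVertex F n) ∧
        h • diagVertex F 1 = k • diagVertex F (-1) := by
  obtain ⟨p, q, r, s, hdet, rfl⟩ := exists_glMk h
  obtain ⟨c, hc, ⟨h1, h2, h3, h4⟩, h5⟩ := glMk_smul_stdVertex_iff.1 hh
  have hvc : Valued.v c ≠ 0 := (Valuation.ne_zero_iff _).2 hc
  -- The neighbours of the standard vertex correspond to points of the projective line over `F`; the
  -- matrix fixes `[O∞ ⊕ π O∞]` if and only if its lower left entry is not of largest valuation.
  rcases lt_or_eq_of_le h3 with hr | hr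
  · left
    refine glMk_smul_diagVertex_iff.2 ⟨c, hc, ⟨h1, ?_, ?_, by simpa using h4⟩, by simpa using h5⟩
    · rw [map_mul, zpow_one]
      exact mul_le_of_le_of_le_one h2 v_unifInf_lt.le
    · have hrc : Valued.v (r / c) ≤ Valued.v (unifInf F) := by
        rw [le_v_unifInf_iff, map_div₀]
        exact (div_lt_one₀ (zero_lt_iff.2 hvc)).2 hr
      have hr' : unifInf F ^ (-1 : ℤ) * r = unifInf F ^ (-1 : ℤ) * (r / c) * c := by
        field_simp
      rw [hr', map_mul, map_mul, zpow_neg_one, map_inv₀]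
      refine mul_le_of_le_one_left' ?_
      rwa [inv_mul_le_one₀ (zero_lt_iff.2 ((Valuation.ne_zero_iff _).2 unifInf_ne_zero))]
  · right
    have hr0 : r ≠ 0 := by
      rintro rfl
      rw [map_zero] at hr
      exact hvc hr.symm
    -- Clear the upper left entry by a unipotent matrix over `O∞`, which fixes the vertices with
    -- `n ≥ 0`; what remains sends `[O∞ ⊕ π O∞]` to `[O∞ ⊕ π⁻¹ O∞]`.
    have hd : (0 : KInf F) * s - (-((p * s - q * r) / r)) * r = p * s - q * r := by
      field_simp; ring
    have hd' : (0 : KInf F) * s - (-((p * s - q * r) / r)) * r ≠ 0 := by rwa [hd]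
    have hfac : glMk p q r s hdet = glMk 1 (p / r) 0 1 (by simp) *
        glMk 0 (-((p * s - q * r) / r)) r s hd' := by
      refine Units.ext ?_
      simp only [Units.val_mul, glMk_val, Matrix.mul_fin_two]
      have h1 : p = 1 * 0 + p / r * r := by field_simp; ring
      have h2 : q = 1 * (-((p * s - q * r) / r)) + p / r * s := by field_simp; ring
      rw [← h1, ← h2]
      simp
    refine ⟨glMk 1 (p / r) 0 1 (by simp), fun n => ?_, ?_⟩
    · refine glMk_smul_diagVertex_iff.2 ⟨1, one_ne_zero, ⟨le_rfl, ?_, by simp, by simp⟩, by simp⟩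
      rw [map_mul, map_div₀, map_one, v_unifInf_zpow]
      refine mul_le_one' ?_ ?_
      · rw [hr]; exact div_le_one_of_le₀ h1 zero_le
      · rw [← WithZero.exp_zero, WithZero.exp_le_exp]; omega
    · rw [hfac, mul_smul, smul_left_cancel_iff, glMk_smul_diagVertex_iff]
      have hπ : Valued.v (unifInf F) ≤ 1 := v_unifInf_lt.le
      refine ⟨unifInf F * c, mul_ne_zero unifInf_ne_zero hc, ⟨by simp, ?_, ?_, ?_⟩, ?_⟩
      · rw [zpow_one, mul_comm, map_mul, map_mul]
        refine mul_le_mul_right ?_ _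
        rw [Valuation.map_neg, map_div₀, h5, hr, sq, mul_div_cancel_right₀ _ hvc]
      · rw [neg_neg, zpow_one, map_mul, map_mul, hr]
      · rw [show (1 : ℤ) - -1 = 2 by norm_num, map_mul, map_mul, map_zpow₀, zpow_ofNat, sq]
        refine mul_le_mul' ?_ h4
        exact mul_le_of_le_one_left' hπ
      · rw [hd, show (1 : ℤ) - -1 = 2 by norm_num, map_mul, map_mul, map_zpow₀, zpow_ofNat, h5,
          mul_pow]

/-- Of the neighbours of `x`, one is nearer to `z ≠ x` than `x`, and all others are farther. -/
theorem btDist_of_btAdj {g : GL (Fin 2) (KInf F)} {n : ℕ} {y : BTVertex F}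
    (hy : BTAdj (g • stdVertex F) y) :
    (y = g • diagVertex F 1 ∧ (1 ≤ n → btDist y (g • diagVertex F n) + 1 = n)) ∨
      btDist y (g • diagVertex F n) = n + 1 := by
  obtain ⟨g', h1, rfl⟩ := btAdj_iff.1 hy
  have hfix : (g⁻¹ * g') • stdVertex F = stdVertex F := by rw [mul_smul, h1, inv_smul_smul]
  have hg' : g' • diagVertex F 1 = g • (g⁻¹ * g') • diagVertex F 1 := by
    rw [smul_smul, mul_inv_cancel_left]
  rcases smul_diagVertex_one hfix with h | ⟨k, hk, h⟩
  · refine Or.inl ⟨by rw [hg', h], fun hn => ?_⟩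
    rw [hg', h]
    obtain ⟨m, rfl⟩ := Nat.exists_eq_add_of_le' hn
    have := btDist_smul_diagVertex (g * diagInf F 1) m
    rw [mul_smul, mul_smul, diagInf_smul_diagVertex] at this
    push_cast
    rw [add_comm (m : ℤ)]
    change btDist (g • diagVertex F 1) _ = _ at this
    rw [this]
  · right
    have := btDist_smul_diagVertex (g * k * diagInf F (-1)) (n + 1)
    rw [mul_smul, mul_smul, mul_smul, mul_smul, diagInf_smul_diagVertex] at this
    push_cast at this
    rw [neg_add_cancel_comm_assoc] at this
    rw [hg', h, ← hk n]
    exact this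

theorem btTree_isTreeDist : (btTree F).IsTreeDist btDist where
  comm := btDist_comm
  self x := by
    obtain ⟨g, rfl⟩ := exists_smul_stdVertex x
    simpa [diagVertex_zero] using btDist_smul_diagVertex g 0
  eq_of_eq_zero x y h := by
    obtain ⟨n, g, rfl, rfl⟩ := exists_smul_pair x y
    rw [btDist_smul_diagVertex] at h
    rw [h, Nat.cast_zero, diagVertex_zero]
  step e z := by
    obtain ⟨⟨x, y⟩, hxy⟩ := e
    change btDist z y = btDist z x + 1 ∨ btDist z x = btDist z y + 1
    rw [btDist_comm z, btDist_comm z]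
    obtain ⟨n, g, rfl, rfl⟩ := exists_smul_pair x z
    rw [btDist_smul_diagVertex]
    rcases btDist_of_btAdj (n := n) hxy with ⟨rfl, h⟩ | h
    · rcases Nat.eq_zero_or_pos n with rfl | hn
      · left
        rw [Nat.cast_zero, diagVertex_zero, btDist_comm]
        exact btDist_smul_diagVertex g 1
      · exact Or.inr (h hn).symm
    · exact Or.inl h
  exists_closer z x hzx := by
    obtain ⟨n, g, rfl, rfl⟩ := exists_smul_pair x z
    refine ⟨⟨(_, _), btAdj_smul_diagVertex_one g⟩, rfl, ?_⟩
    change btDist _ (g • diagVertex F 1) < _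
    rw [btDist_comm, btDist_comm _ (g • stdVertex F), btDist_smul_diagVertex]
    have hn : 1 ≤ n := by
      rw [Nat.one_le_iff_ne_zero]
      rintro rfl
      exact hzx (by rw [Nat.cast_zero, diagVertex_zero])
    obtain ⟨m, rfl⟩ := Nat.exists_eq_add_of_le' hn
    have := btDist_smul_diagVertex (g * diagInf F 1) m
    rw [mul_smul, mul_smul, diagInf_smul_diagVertex] at this
    change btDist (g • diagVertex F 1) _ = _ at this
    push_cast
    rw [add_comm (m : ℤ), this]
    omega
  unique_closer z := by
    rintro ⟨⟨x, y⟩, hy⟩ ⟨⟨x', y'⟩, hy'⟩ h h1 h2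
    obtain rfl : x = x' := h
    change btDist z y < btDist z x at h1
    change btDist z y' < btDist z x at h2
    rw [btDist_comm z, btDist_comm z] at h1 h2
    obtain ⟨n, g, rfl, rfl⟩ := exists_smul_pair x z
    change btDist y _ < btDist (g • stdVertex F) _ at h1
    change btDist y' _ < btDist (g • stdVertex F) _ at h2
    rw [btDist_smul_diagVertex] at h1 h2
    have e1 := (btDist_of_btAdj (n := n) hy).resolve_right fun h => by
      change btDist y _ = _ at h; omega
    have e2 := (btDist_of_btAdj (n := n) hy').resolve_right fun h => by
      change btDist y' _ = _ at h; omega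
    exact Subtype.ext (Prod.ext rfl (e1.1.trans e2.1.symm))

end Tree

/-! ### Determinants of elements of an order -/

/-- Left multiplication by `M` acts as `M` on each column. -/
theorem Matrix.det_mulLeft_eq_pow {n R : Type*} [Fintype n] [DecidableEq n] [CommRing R]
    (M : Matrix n n R) :
    LinearMap.det (LinearMap.mulLeft R M) = M.det ^ Fintype.card n := by
  have h : (Matrix.transposeLinearEquiv n n R R : _ ≃ₗ[R] _).toLinearMap ∘ₗ
      LinearMap.mulLeft R M ∘ₗ
      (Matrix.transposeLinearEquiv n n R R).symm.toLinearMap =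
      (LinearMap.pi fun i : n => (Matrix.toLin' M).comp (LinearMap.proj i) :
        (n → n → R) →ₗ[R] (n → n → R)) := by
    refine LinearMap.ext fun N => ?_
    ext i j
    simp only [LinearMap.comp_apply, LinearEquiv.coe_coe, LinearMap.mulLeft_apply]
    simp [Matrix.mul_apply]
    rfl
  have h1 := LinearMap.det_conj (LinearMap.mulLeft R M) (Matrix.transposeLinearEquiv n n R R)
  have h2 := LinearMap.det_pi (fun _ : n => Matrix.toLin' M)
  rw [← h1]
  refine (congrArg LinearMap.det h).trans (h2.trans ?_)
  simp [LinearMap.det_toLin']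

section Order

variable {F : Type*} [Field F] [DecidableEq (RatFunc F)]
variable {D : Type*} [DivisionRing D] [Algebra (RatFunc F) D]
variable (φ : KInf F ⊗[RatFunc F] D ≃ₐ[KInf F] Matrix (Fin 2) (Fin 2) (KInf F))

theorem splitEmbedding_apply (x : D) : splitEmbedding φ x = φ (1 ⊗ₜ x) := rfl

theorem splitEmbedding_algebraMap (r : RatFunc F) :
    splitEmbedding φ (algebraMap (RatFunc F) D r) =
      algebraMap (KInf F) _ (algebraMap (RatFunc F) (KInf F) r) := by
  rw [splitEmbedding_apply, ← φ.commutes]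
  congr 1
  rw [Algebra.TensorProduct.algebraMap_apply, Algebra.algebraMap_self, RingHom.id_apply,
    Algebra.algebraMap_eq_smul_one, Algebra.algebraMap_eq_smul_one, TensorProduct.tmul_smul,
    TensorProduct.smul_tmul']

theorem det_splitEmbedding_ne_zero {x : D} (hx : x ≠ 0) : (splitEmbedding φ x).det ≠ 0 := by
  have h : (splitEmbedding φ x).det * (splitEmbedding φ x⁻¹).det = 1 := by
    rw [← Matrix.det_mul, ← map_mul, mul_inv_cancel₀ hx, map_one, Matrix.det_one]
  exact left_ne_zero_of_mul_eq_one h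

variable [Algebra F[X] D] [IsScalarTower F[X] (RatFunc F) D] {Λ : Subalgebra F[X] D}

/-- The square of the determinant of an element `x` of an order is the determinant of the left
multiplication by `x`, hence a polynomial. -/
theorem exists_det_sq_eq (hΛ : IsOrder Λ) {x : D} (hx : x ∈ Λ) :
    ∃ p : F[X], (splitEmbedding φ x).det ^ 2 =
      algebraMap (RatFunc F) (KInf F) (algebraMap F[X] (RatFunc F) p) := by
  classical
  have hfin : Module.Finite F[X] Λ := Module.Finite.iff_fg.2 hΛ.1
  have hinj : Function.Injective (algebraMap F[X] D) := by
    rw [IsScalarTower.algebraMap_eq F[X] (RatFunc F) D]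
    exact (algebraMap (RatFunc F) D).injective.comp (IsFractionRing.injective F[X] (RatFunc F))
  have htf : Module.IsTorsionFree F[X] D := by
    rw [Module.isTorsionFree_iff_smul_eq_zero]
    intro p y h
    rw [Algebra.smul_def, mul_eq_zero, map_eq_zero_iff _ hinj] at h
    exact h
  have hfree : Module.Free F[X] Λ := inferInstance
  -- A basis of `Λ` over `F[X]` is a basis of `D` over `F(X)`, and its image a basis of `M₂(K∞)`; in
  -- these bases the left multiplication by `x` has the same matrix `a`, with polynomial entries.
  let b := Module.Free.chooseBasis F[X] Λ
  have hli : LinearIndependent (RatFunc F) (fun i => (b i : D)) := by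
    rw [← LinearIndependent.iff_fractionRing (R := F[X])]
    exact b.linearIndependent.map' Λ.val.toLinearMap
      (LinearMap.ker_eq_bot.2 Subtype.val_injective)
  have hsp : ⊤ ≤ Submodule.span (RatFunc F) (Set.range fun i => (b i : D)) := by
    rw [← hΛ.2, Submodule.span_le]
    intro y hy
    have := b.sum_repr ⟨y, hy⟩
    have h2 : ∑ i, b.repr ⟨y, hy⟩ i • (b i : D) = y := by
      have h := congrArg Λ.val this
      rw [map_sum] at h
      exact h
    rw [SetLike.mem_coe, ← h2]
    refine Submodule.sum_mem _ fun i _ => ?_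
    rw [← IsScalarTower.algebraMap_smul (RatFunc F)]
    exact Submodule.smul_mem _ _ (Submodule.subset_span ⟨i, rfl⟩)
  let bD : Module.Basis _ (RatFunc F) D := Module.Basis.mk hli hsp
  let bM := (bD.baseChange (KInf F)).map φ.toLinearEquiv
  have hbM : ∀ i, bM i = splitEmbedding φ (b i) := fun i => by
    simp [bM, bD, splitEmbedding_apply]
  let a : Matrix _ _ F[X] := fun i j => b.repr (⟨x, hx⟩ * b j) i
  have hmul : ∀ j, splitEmbedding φ x * bM j = ∑ i,
      algebraMap (RatFunc F) (KInf F) (algebraMap F[X] (RatFunc F) (a i j)) • bM i := by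
    intro j
    have h := congrArg (splitEmbedding φ) (congrArg Λ.val (b.sum_repr (⟨x, hx⟩ * b j)))
    rw [map_sum, map_sum] at h
    simp only [hbM]
    rw [← map_mul]
    refine h.symm.trans (Finset.sum_congr rfl fun i _ => ?_)
    rw [map_smul, ← IsScalarTower.algebraMap_smul (RatFunc F), Algebra.smul_def, map_mul,
      splitEmbedding_algebraMap, ← Algebra.smul_def]
    rfl
  have hmat : LinearMap.toMatrix bM bM (LinearMap.mulLeft (KInf F) (splitEmbedding φ x)) =
      a.map ((algebraMap (RatFunc F) (KInf F)).comp (algebraMap F[X] (RatFunc F))) := by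
    ext i j
    rw [LinearMap.toMatrix_apply, LinearMap.mulLeft_apply, hmul, map_sum, Finsupp.finsetSum_apply]
    simp only [map_smul, Module.Basis.repr_self, Finsupp.smul_apply, Finsupp.single_apply,
      smul_eq_mul, mul_ite, mul_one, mul_zero, Finset.sum_ite_eq', Finset.mem_univ, if_true,
      Matrix.map_apply]
    rfl
  refine ⟨a.det, ?_⟩
  have h1 := Matrix.det_mulLeft_eq_pow (splitEmbedding φ x)
  rw [Fintype.card_fin, ← LinearMap.det_toMatrix bM, hmat] at h1
  rw [← h1, ← RingHom.comp_apply, RingHom.map_det]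
  rfl

theorem one_le_v_det (hΛ : IsOrder Λ) {x : D} (hx : x ∈ Λ) (hx0 : x ≠ 0) :
    1 ≤ Valued.v (splitEmbedding φ x).det := by
  obtain ⟨p, hp⟩ := exists_det_sq_eq φ hΛ hx
  have hp0 : p ≠ 0 := by
    rintro rfl
    rw [map_zero, map_zero] at hp
    exact det_splitEmbedding_ne_zero φ hx0 (pow_eq_zero_iff two_ne_zero |>.1 hp)
  have h := one_le_v_polynomial hp0
  rw [← hp, map_pow] at h
  exact (one_le_pow_iff_of_nonneg zero_le two_ne_zero).1 h

end Order

/-! ### Vertex stabilizers in the unit group -/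

section Stabilizers

variable {F : Type*} [Field F] [DecidableEq (RatFunc F)]
variable {D : Type*} [DivisionRing D] [Algebra (RatFunc F) D]
variable (φ : KInf F ⊗[RatFunc F] D ≃ₐ[KInf F] Matrix (Fin 2) (Fin 2) (KInf F))

/-- The embedding of `D` in `M₂(K∞)` in the coordinates of the lattice `g O∞²`. -/
def conjEmbedding (g : GL (Fin 2) (KInf F)) : D →+* Matrix (Fin 2) (Fin 2) (KInf F) where
  toFun x := (g⁻¹).val * splitEmbedding φ x * g.val
  map_one' := by rw [map_one, mul_one, Units.inv_mul]
  map_mul' x y := by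
    simp only [map_mul, mul_assoc]
    rw [Units.mul_inv_cancel_left]
  map_zero' := by rw [map_zero, mul_zero, zero_mul]
  map_add' x y := by rw [map_add, mul_add, add_mul]

variable {φ}

theorem conjEmbedding_apply (g : GL (Fin 2) (KInf F)) (x : D) :
    conjEmbedding φ g x = (g⁻¹).val * splitEmbedding φ x * g.val := rfl

theorem det_conjEmbedding (g : GL (Fin 2) (KInf F)) (x : D) :
    (conjEmbedding φ g x).det = (splitEmbedding φ x).det := by
  rw [conjEmbedding_apply, Matrix.det_mul, Matrix.det_mul, mul_right_comm, ← Matrix.det_mul,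
    Units.inv_mul, Matrix.det_one, one_mul]

variable (D) in
/-- The embedding of the constants in `D`. -/
def constD : F →+* D := (algebraMap (RatFunc F) D).comp RatFunc.C

theorem splitEmbedding_constD (c : F) :
    splitEmbedding φ (constD D c) = algebraMap (KInf F) _ (constInf F c) :=
  splitEmbedding_algebraMap φ _

theorem conjEmbedding_constD (g : GL (Fin 2) (KInf F)) (c : F) :
    conjEmbedding φ g (constD D c) = algebraMap (KInf F) _ (constInf F c) := by
  rw [conjEmbedding_apply, splitEmbedding_constD, ← Algebra.commutes, mul_assoc, Units.inv_mul,
    mul_one]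

variable [Algebra F[X] D]

/-- The elements of an order that preserve the lattice `g O∞²`. -/
def latticeRing (φ : KInf F ⊗[RatFunc F] D ≃ₐ[KInf F] Matrix (Fin 2) (Fin 2) (KInf F))
    (Λ : Subalgebra F[X] D) (g : GL (Fin 2) (KInf F)) : Subring D where
  carrier := {x | x ∈ Λ ∧ ∀ i j, Valued.v (conjEmbedding φ g x i j) ≤ 1}
  one_mem' := ⟨one_mem _, fun i j => by rw [map_one, Matrix.one_apply]; split_ifs <;> simp⟩
  mul_mem' := by
    rintro x y ⟨hx, hx'⟩ ⟨hy, hy'⟩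
    refine ⟨mul_mem hx hy, fun i j => ?_⟩
    rw [map_mul, Matrix.mul_apply]
    refine Valuation.map_sum_le _ fun k _ => ?_
    rw [map_mul]
    exact mul_le_one' (hx' i k) (hy' k j)
  zero_mem' := ⟨zero_mem _, fun i j => by simp⟩
  add_mem' := by
    rintro x y ⟨hx, hx'⟩ ⟨hy, hy'⟩
    refine ⟨add_mem hx hy, fun i j => ?_⟩
    rw [map_add, Matrix.add_apply]
    exact (Valuation.map_add _ _ _).trans (max_le (hx' i j) (hy' i j))
  neg_mem' := by
    rintro x ⟨hx, hx'⟩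
    refine ⟨neg_mem hx, fun i j => ?_⟩
    rw [map_neg, Matrix.neg_apply, Valuation.map_neg]
    exact hx' i j

variable [IsScalarTower F[X] (RatFunc F) D] {Λ : Subalgebra F[X] D}
variable {g : GL (Fin 2) (KInf F)}

omit [DecidableEq (RatFunc F)] in
theorem algebraMap_C_eq_constD (c : F) : algebraMap F[X] D (Polynomial.C c) = constD D c := by
  rw [IsScalarTower.algebraMap_apply F[X] (RatFunc F) D, RatFunc.algebraMap_C]
  rfl

theorem constD_mem_latticeRing (c : F) : constD D c ∈ latticeRing φ Λ g := by
  refine ⟨by rw [← algebraMap_C_eq_constD]; exact Λ.algebraMap_mem _, fun i j => ?_⟩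
  rw [conjEmbedding_constD, Matrix.algebraMap_matrix_apply]
  split_ifs
  · exact v_constInf_le c
  · simp

omit [DecidableEq (RatFunc F)] [Algebra F[X] D] [IsScalarTower F[X] (RatFunc F) D] in
theorem constD_comm (c : F) (x : D) : constD D c * x = x * constD D c :=
  Algebra.commutes _ _

/-- A nonzero element of an order has a determinant of valuation at least one, so that it cannot
map a basis vector of a lattice it preserves into `π` times the lattice. -/
theorem eq_zero_of_column (hΛ : IsOrder Λ) {x : D} (hx : x ∈ latticeRing φ Λ g)
    (h : ∀ i, Valued.v (conjEmbedding φ g x i 0) < 1) : x = 0 := by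
  by_contra hx0
  have h1 := one_le_v_det φ hΛ hx.1 hx0
  rw [← det_conjEmbedding g, Matrix.det_fin_two] at h1
  refine absurd h1 (not_le.2 ((Valuation.map_sub _ _ _).trans_lt (max_lt ?_ ?_)))
  · rw [map_mul]
    exact (mul_le_of_le_one_right' (hx.2 1 1)).trans_lt (h 0)
  · rw [map_mul]
    exact (mul_le_of_le_one_left' (hx.2 0 1)).trans_lt (h 1)

variable (φ Λ g) in
/-- The residues of the coordinates of the image of the first basis vector of `g O∞²`. -/
def residueColumn (x : latticeRing φ Λ g) (i : Fin 2) : F :=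
  (exists_constInf_sub_lt _ (x.2.2 i 0)).choose

omit [IsScalarTower F[X] (RatFunc F) D] in
theorem v_sub_residueColumn (x : latticeRing φ Λ g) (i : Fin 2) :
    Valued.v (conjEmbedding φ g (x : D) i 0 - constInf F (residueColumn φ Λ g x i)) < 1 :=
  (exists_constInf_sub_lt _ (x.2.2 i 0)).choose_spec

theorem residueColumn_injective (hΛ : IsOrder Λ) :
    Function.Injective (residueColumn φ Λ g) := by
  intro x y hxy
  rw [← sub_eq_zero]
  refine Subtype.ext (eq_zero_of_column hΛ (x - y).2 fun i => ?_)
  have h1 := v_sub_residueColumn x i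
  have h2 := v_sub_residueColumn y i
  rw [hxy] at h1
  have : conjEmbedding φ g ((x - y : latticeRing φ Λ g) : D) i 0 =
      (conjEmbedding φ g (x : D) i 0 - constInf F (residueColumn φ Λ g y i)) -
      (conjEmbedding φ g (y : D) i 0 - constInf F (residueColumn φ Λ g y i)) := by
    rw [AddSubgroupClass.coe_sub, map_sub, Matrix.sub_apply]; ring
  rw [this]
  exact (Valuation.map_sub _ _ _).trans_lt (max_lt h1 h2)

section

variable [Finite F]

theorem finite_latticeRing (hΛ : IsOrder Λ) : Finite (latticeRing φ Λ g) :=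
  Finite.of_injective _ (residueColumn_injective hΛ)

theorem isField_latticeRing (hΛ : IsOrder Λ) : IsField (latticeRing φ Λ g) :=
  have := finite_latticeRing (φ := φ) (g := g) hΛ
  Finite.isDomain_to_isField _

/-- If a lattice is preserved by a non-constant element of the order, then the elements preserving
it form a field with `q ^ 2` elements, which acts simply transitively on `L / π L ∖ 0`. -/
theorem residueColumn_bijective (hΛ : IsOrder Λ) {x : D} (hx : x ∈ latticeRing φ Λ g)
    (hxc : ∀ c : F, x ≠ constD D c) : Function.Bijective (residueColumn φ Λ g) := by
  have := finite_latticeRing (φ := φ) (g := g) hΛ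
  -- The elements `a₀ + a₁ x` with `a₀`, `a₁` in `F` are distinct: there are `q ^ 2` of them.
  have h : Function.Injective (fun a : Fin 2 → F =>
      (⟨constD D (a 0) + constD D (a 1) * x, add_mem (constD_mem_latticeRing _)
        (mul_mem (constD_mem_latticeRing _) hx)⟩ : latticeRing φ Λ g)) := by
    intro a b hab
    have hab' : constD D (a 0) + constD D (a 1) * x = constD D (b 0) + constD D (b 1) * x :=
      congrArg Subtype.val hab
    have key : constD D (a 1 - b 1) * x = constD D (b 0 - a 0) := by
      rw [map_sub, map_sub, sub_mul, sub_eq_sub_iff_add_eq_add, add_comm, hab', add_comm]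
    have h1 : a 1 = b 1 := by
      by_contra hne
      refine hxc ((a 1 - b 1)⁻¹ * (b 0 - a 0)) ?_
      rw [map_mul, ← key, ← mul_assoc, ← map_mul, inv_mul_cancel₀ (sub_ne_zero.2 hne), map_one,
        one_mul]
    have h0 : a 0 = b 0 := by
      rw [h1, sub_self, map_zero, zero_mul, eq_comm, map_eq_zero, sub_eq_zero] at key
      exact key.symm
    ext i
    fin_cases i
    exacts [h0, h1]
  exact (residueColumn_injective hΛ).bijective_of_nat_card_le (Nat.card_le_card_of_injective _ h)

theorem card_latticeRing (hΛ : IsOrder Λ) {x : D} (hx : x ∈ latticeRing φ Λ g)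
    (hxc : ∀ c : F, x ≠ constD D c) : Nat.card (latticeRing φ Λ g) = Nat.card F ^ 2 := by
  rw [Nat.card_congr (Equiv.ofBijective _ (residueColumn_bijective hΛ hx hxc)), Nat.card_fun,
    Nat.card_fin]

end

/-! ### The action of the unit group on the tree -/

omit [IsScalarTower F[X] (RatFunc F) D] in
theorem unitEmbedding_injective : Function.Injective (unitEmbedding φ Λ) :=
  Units.map_injective ((splitEmbedding φ).injective.comp Subtype.val_injective)

variable (φ Λ) in
/-- The unit of `Λ`, as an element of `D`, underlying an element of `Γ`. -/
def unitGroupToD : unitGroup φ Λ →* D :=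
  (Λ.val.toRingHom.toMonoidHom.comp (Units.coeHom Λ)).comp
    (MonoidHom.ofInjective (unitEmbedding_injective (φ := φ) (Λ := Λ))).symm.toMonoidHom

omit [IsScalarTower F[X] (RatFunc F) D] in
theorem splitEmbedding_unitGroupToD (γ : unitGroup φ Λ) :
    splitEmbedding φ (unitGroupToD φ Λ γ) = γ.1.val := by
  obtain ⟨u, rfl⟩ := (MonoidHom.ofInjective
    (unitEmbedding_injective (φ := φ) (Λ := Λ))).surjective γ
  have h : unitGroupToD φ Λ (MonoidHom.ofInjective
      (unitEmbedding_injective (φ := φ) (Λ := Λ)) u) = ((u : Λ) : D) :=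
    congrArg (fun u : Λˣ => ((u : Λ) : D)) (MulEquiv.symm_apply_apply _ u)
  rw [h]
  rfl

omit [IsScalarTower F[X] (RatFunc F) D] in
theorem unitGroupToD_mem (γ : unitGroup φ Λ) : unitGroupToD φ Λ γ ∈ Λ :=
  Subtype.property _

omit [IsScalarTower F[X] (RatFunc F) D] in
theorem unitGroupToD_injective : Function.Injective (unitGroupToD φ Λ) := by
  intro γ δ h
  refine Subtype.ext (Units.ext ?_)
  rw [← splitEmbedding_unitGroupToD, h, splitEmbedding_unitGroupToD]

omit [IsScalarTower F[X] (RatFunc F) D] in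
theorem exists_unitGroupToD {x y : D} (hx : x ∈ Λ) (hy : y ∈ Λ) (hxy : x * y = 1) :
    ∃ γ, unitGroupToD φ Λ γ = x := by
  have hyx : y * x = 1 := by
    have hx0 : x ≠ 0 := left_ne_zero_of_mul_eq_one hxy
    rw [eq_inv_of_mul_eq_one_right hxy, inv_mul_cancel₀ hx0]
  let u : Λˣ := ⟨⟨x, hx⟩, ⟨y, hy⟩, Subtype.ext hxy, Subtype.ext hyx⟩
  refine ⟨⟨_, u, rfl⟩, (splitEmbedding φ).injective ?_⟩
  rw [splitEmbedding_unitGroupToD]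
  rfl

theorem unitGroupToD_scalarEmbedding (c : Fˣ) :
    unitGroupToD φ Λ (scalarEmbedding φ Λ c) = constD D (c : F) := by
  refine (splitEmbedding φ).injective ?_
  rw [splitEmbedding_unitGroupToD, ← algebraMap_C_eq_constD]
  rfl

theorem scalarEmbedding_injective : Function.Injective (scalarEmbedding φ Λ) := by
  intro c d h
  have := congrArg (unitGroupToD φ Λ) h
  rw [unitGroupToD_scalarEmbedding, unitGroupToD_scalarEmbedding] at this
  exact Units.ext ((constD D).injective this)

theorem mem_range_scalarEmbedding_iff {γ : unitGroup φ Λ} :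
    γ ∈ (scalarEmbedding φ Λ).range ↔ ∃ c : F, unitGroupToD φ Λ γ = constD D c := by
  constructor
  · rintro ⟨c, rfl⟩
    exact ⟨c, unitGroupToD_scalarEmbedding c⟩
  · rintro ⟨c, hc⟩
    have hc0 : c ≠ 0 := by
      rintro rfl
      have := congrArg (unitGroupToD φ Λ) (mul_inv_cancel γ)
      rw [map_mul, hc, map_zero, zero_mul, map_one] at this
      exact zero_ne_one this
    refine ⟨Units.mk0 c hc0, unitGroupToD_injective ?_⟩
    rw [unitGroupToD_scalarEmbedding, hc, Units.val_mk0]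

theorem scalarEmbedding_commute (c : Fˣ) (γ : unitGroup φ Λ) :
    Commute γ (scalarEmbedding φ Λ c) := by
  refine unitGroupToD_injective ?_
  rw [map_mul, map_mul, unitGroupToD_scalarEmbedding, constD_comm]

/-- Both `γ` and `γ⁻¹` have a determinant of valuation at least one. -/
theorem v_det_unitGroup (hΛ : IsOrder Λ) (γ : unitGroup φ Λ) :
    Valued.v γ.1.val.det = 1 := by
  have h : ∀ γ : unitGroup φ Λ, 1 ≤ Valued.v γ.1.val.det := by
    intro γ
    rw [← splitEmbedding_unitGroupToD]
    refine one_le_v_det φ hΛ (unitGroupToD_mem γ) ?_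
    refine left_ne_zero_of_mul_eq_one (b := unitGroupToD φ Λ γ⁻¹) ?_
    rw [← map_mul, mul_inv_cancel, map_one]
  have h1 : Valued.v γ.1.val.det * Valued.v (γ⁻¹).1.val.det = 1 := by
    rw [← map_mul, ← Matrix.det_mul]
    change Valued.v (γ.1.val * (γ.1⁻¹).val).det = 1
    rw [Units.mul_inv, Matrix.det_one, map_one]
  refine le_antisymm ?_ (h γ)
  rw [← h1]
  exact le_mul_of_one_le_right' (h γ⁻¹)

omit [IsScalarTower F[X] (RatFunc F) D] in
theorem conjEmbedding_unitGroupToD (γ : unitGroup φ Λ) :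
    conjEmbedding φ g (unitGroupToD φ Λ γ) = (g⁻¹ * γ.1 * g).val := by
  rw [conjEmbedding_apply, splitEmbedding_unitGroupToD]
  rfl

/-- The stabilizer of the vertex `[g O∞²]` preserves the lattice `g O∞²`, as determinants of units
of `Λ` are units at `∞`. -/
theorem smul_eq_iff_mem_latticeRing (hΛ : IsOrder Λ) {γ : unitGroup φ Λ} :
    γ • g • stdVertex F = g • stdVertex F ↔ unitGroupToD φ Λ γ ∈ latticeRing φ Λ g := by
  have hdet : Valued.v (g⁻¹ * γ.1 * g).val.det = 1 := by
    rw [← conjEmbedding_unitGroupToD, det_conjEmbedding, splitEmbedding_unitGroupToD,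
      v_det_unitGroup hΛ]
  have h : γ • g • stdVertex F = g • stdVertex F ↔
      (g⁻¹ * γ.1 * g) • stdVertex F = stdVertex F := by
    rw [mul_smul, mul_smul, inv_smul_eq_iff]
    rfl
  rw [h, smul_stdVertex_iff, hdet]
  constructor
  · rintro ⟨c, hc, h1, h2⟩
    have hc1 : Valued.v c = 1 := (pow_eq_one_iff_of_nonneg zero_le two_ne_zero).1 h2.symm
    refine ⟨unitGroupToD_mem γ, fun i j => ?_⟩
    rw [conjEmbedding_unitGroupToD, ← hc1]
    exact h1 i j
  · rintro ⟨-, h1⟩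
    refine ⟨1, one_ne_zero, fun i j => ?_, by simp⟩
    rw [← conjEmbedding_unitGroupToD, map_one]
    exact h1 i j

theorem scalarEmbedding_smul (hΛ : IsOrder Λ) (c : Fˣ) (x : BTVertex F) :
    scalarEmbedding φ Λ c • x = x := by
  obtain ⟨g, rfl⟩ := exists_smul_stdVertex x
  rw [smul_eq_iff_mem_latticeRing hΛ, unitGroupToD_scalarEmbedding]
  exact constD_mem_latticeRing _

/-- In the stabilizer of the standard vertex, the stabilizer of the edge to `[O∞ ⊕ π O∞]` consists
of the matrices that are, up to scaling, integral and upper triangular modulo `π`. -/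
theorem smul_diagVertex_one_iff {h : GL (Fin 2) (KInf F)} (hh : h • stdVertex F = stdVertex F) :
    h • diagVertex F 1 = diagVertex F 1 ↔ Valued.v (h.val 1 0) ^ 2 < Valued.v h.val.det := by
  obtain ⟨p, q, r, s, hd, rfl⟩ := exists_glMk h
  obtain ⟨c, hc, ⟨h1, h2, h3, h4⟩, h5⟩ := glMk_smul_stdVertex_iff.1 hh
  have hvc : Valued.v c ≠ 0 := (Valuation.ne_zero_iff _).2 hc
  have hπ : Valued.v (unifInf F) ≠ 0 := (Valuation.ne_zero_iff _).2 unifInf_ne_zero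
  have key : Valued.v (unifInf F ^ (-1 : ℤ) * r) ≤ Valued.v c ↔ Valued.v r < Valued.v c := by
    rw [map_mul, zpow_neg_one, map_inv₀, inv_mul_le_iff₀ (zero_lt_iff.2 hπ),
      ← div_lt_one₀ (zero_lt_iff.2 hvc), ← le_v_unifInf_iff (F := F),
      div_le_iff₀ (zero_lt_iff.2 hvc)]
  rw [glMk_smul_diagVertex_iff, glMk_val, Matrix.det_fin_two_of, h5]
  change _ ↔ Valued.v r ^ 2 < _
  rw [pow_lt_pow_iff_left₀ zero_le zero_le two_ne_zero, ← key]
  constructor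
  · rintro ⟨c', hc', ⟨-, -, h3', -⟩, h5'⟩
    rw [sub_self, zpow_zero, one_mul, h5, pow_left_inj₀ zero_le zero_le two_ne_zero] at h5'
    rwa [h5']
  · intro hr
    refine ⟨c, hc, ⟨h1, ?_, hr, by simpa using h4⟩, by simpa using h5⟩
    rw [map_mul, zpow_one]
    exact mul_le_of_le_of_le_one h2 v_unifInf_lt.le

/-- Edge stabilizers consist of constants. -/
theorem mem_range_of_smul_edge (hΛ : IsOrder Λ) {γ : unitGroup φ Λ}
    (h0 : γ • g • stdVertex F = g • stdVertex F)
    (h1 : γ • g • diagVertex F 1 = g • diagVertex F 1) : γ ∈ (scalarEmbedding φ Λ).range := by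
  have hmem := (smul_eq_iff_mem_latticeRing hΛ).1 h0
  have hent : Valued.v (conjEmbedding φ g (unitGroupToD φ Λ γ) 1 0) < 1 := by
    have hdet : Valued.v (g⁻¹ * γ.1 * g).val.det = 1 := by
      rw [← conjEmbedding_unitGroupToD, det_conjEmbedding, splitEmbedding_unitGroupToD,
        v_det_unitGroup hΛ]
    have h0' : (g⁻¹ * γ.1 * g) • stdVertex F = stdVertex F := by
      rw [mul_smul, mul_smul, inv_smul_eq_iff]
      exact h0
    have h1' : (g⁻¹ * γ.1 * g) • diagVertex F 1 = diagVertex F 1 := by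
      rw [mul_smul, mul_smul, inv_smul_eq_iff]
      exact h1
    rwa [smul_diagVertex_one_iff h0', hdet, pow_lt_one_iff_of_nonneg zero_le two_ne_zero,
      ← conjEmbedding_unitGroupToD] at h1'
  -- The first basis vector is an eigenvector of `γ` modulo `π`; its eigenvalue is the constant `c`.
  obtain ⟨c, hc⟩ := exists_constInf_sub_lt _ (hmem.2 0 0)
  rw [mem_range_scalarEmbedding_iff]
  refine ⟨c, sub_eq_zero.1 (eq_zero_of_column hΛ (sub_mem hmem (constD_mem_latticeRing c)) ?_)⟩
  rw [Fin.forall_fin_two]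
  simp only [map_sub, Matrix.sub_apply, conjEmbedding_constD, Matrix.algebraMap_matrix_apply]
  simpa using ⟨hc, hent⟩

/-- Every nonzero element of the finite field of elements of `Λ` preserving `g O∞²` is in `Γ`. -/
theorem exists_unitGroupToD_of_mem_latticeRing [Finite F] (hΛ : IsOrder Λ) {x : D}
    (hx : x ∈ latticeRing φ Λ g) (hx0 : x ≠ 0) : ∃ γ : unitGroup φ Λ,
      unitGroupToD φ Λ γ = x ∧ γ • g • stdVertex F = g • stdVertex F := by
  obtain ⟨y, hy⟩ := (isField_latticeRing hΛ).mul_inv_cancel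
    (a := (⟨x, hx⟩ : latticeRing φ Λ g)) (fun h => hx0 (congrArg Subtype.val h))
  obtain ⟨γ, hγ⟩ := exists_unitGroupToD (φ := φ) hx.1 y.2.1 (congrArg Subtype.val hy)
  exact ⟨γ, hγ, (smul_eq_iff_mem_latticeRing hΛ).2 (hγ ▸ hx)⟩

/-- If the stabilizer of `[g O∞²]` contains a non-constant element, then it acts transitively on
the neighbours. -/
theorem exists_smul_diagVertex_one_eq [Finite F] (hΛ : IsOrder Λ) {γ : unitGroup φ Λ}
    (hγ : γ • g • stdVertex F = g • stdVertex F) (hγc : γ ∉ (scalarEmbedding φ Λ).range)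
    {k : GL (Fin 2) (KInf F)} (hk : k • stdVertex F = stdVertex F) :
    ∃ δ : unitGroup φ Λ, δ • g • stdVertex F = g • stdVertex F ∧
      δ • g • diagVertex F 1 = g • k • diagVertex F 1 := by
  obtain ⟨c, hc, hk1, hkdet⟩ := smul_stdVertex_iff.1 hk
  have hvc : Valued.v c ≠ 0 := (Valuation.ne_zero_iff _).2 hc
  have hmem := (smul_eq_iff_mem_latticeRing hΛ).1 hγ
  have hxc : ∀ d : F, unitGroupToD φ Λ γ ≠ constD D d := fun d hd =>
    hγc (mem_range_scalarEmbedding_iff.2 ⟨d, hd⟩)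
  -- The first column of the integral matrix `c⁻¹ k`, modulo `π`.
  have hk2 : ∀ i j, Valued.v (k.val i j / c) ≤ 1 := fun i j => by
    rw [map_div₀]; exact div_le_one_of_le₀ (hk1 i j) zero_le
  choose a ha using fun i => exists_constInf_sub_lt _ (hk2 i 0)
  -- An element of `Λ` with the same first column modulo `π` has the same effect on the edge.
  obtain ⟨x, hx⟩ := (residueColumn_bijective hΛ hmem hxc).surjective a
  have hxa : ∀ i, Valued.v (conjEmbedding φ g (x : D) i 0 - k.val i 0 / c) < 1 := by
    intro i
    have h1 := v_sub_residueColumn x i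
    rw [hx] at h1
    have : conjEmbedding φ g (x : D) i 0 - k.val i 0 / c =
        (conjEmbedding φ g (x : D) i 0 - constInf F (a i)) -
          (k.val i 0 / c - constInf F (a i)) := by ring
    rw [this]
    exact (Valuation.map_sub _ _ _).trans_lt (max_lt h1 (ha i))
  have hkd : Valued.v (k.val 0 0 * k.val 1 1 - k.val 0 1 * k.val 1 0) = Valued.v c ^ 2 := by
    rw [← Matrix.det_fin_two, hkdet]
  have hx0 : (x : D) ≠ 0 := by
    intro h0
    have h1 : ∀ i, Valued.v (k.val i 0) < Valued.v c := by
      intro i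
      have := hxa i
      rw [h0, map_zero, Matrix.zero_apply, zero_sub, Valuation.map_neg, map_div₀] at this
      exact (div_lt_one₀ (zero_lt_iff.2 hvc)).1 this
    rcases v_eq_or_v_eq hvc (hk1 0 0) (hk1 0 1) (hk1 1 0) (hk1 1 1) hkd with h | h
    · exact (h1 0).ne h
    · exact (h1 1).ne h
  obtain ⟨δ, hδ, hδ'⟩ := exists_unitGroupToD_of_mem_latticeRing hΛ x.2 hx0
  refine ⟨δ, hδ', ?_⟩
  have hN := conjEmbedding_unitGroupToD (g := g) δ
  rw [hδ] at hN
  set N : GL (Fin 2) (KInf F) := g⁻¹ * δ.1 * g with hNdef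
  have hNdet : Valued.v N.val.det = 1 := by
    rw [← hN, det_conjEmbedding, ← hδ, splitEmbedding_unitGroupToD, v_det_unitGroup hΛ]
  have hNstd : N • stdVertex F = stdVertex F :=
    smul_stdVertex_iff.2 ⟨1, one_ne_zero, fun i j => by rw [← hN, map_one]; exact x.2.2 i j,
      by rw [hNdet, map_one, one_pow]⟩
  have hgoal : N • diagVertex F 1 = k • diagVertex F 1 := by
    have hstd : (k⁻¹ * N) • stdVertex F = stdVertex F := by
      rw [mul_smul, hNstd, inv_smul_eq_iff, hk]
    have hent : (k⁻¹ * N).val 1 0 =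
        (k.val.det)⁻¹ * (k.val 0 0 * (N.val 1 0 - k.val 1 0 / c) -
          k.val 1 0 * (N.val 0 0 - k.val 0 0 / c)) := by
      rw [Units.val_mul, Matrix.coe_units_inv, Matrix.inv_def, Ring.inverse_eq_inv',
        Matrix.adjugate_fin_two, Matrix.smul_mul, Matrix.smul_apply, smul_eq_mul,
        Matrix.mul_apply, Fin.sum_univ_two]
      simp only [Matrix.of_apply, Matrix.cons_val_zero, Matrix.cons_val_one, Matrix.cons_val']
      ring
    have hlt : Valued.v (k.val 0 0 * (N.val 1 0 - k.val 1 0 / c) -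
          k.val 1 0 * (N.val 0 0 - k.val 0 0 / c)) < Valued.v c := by
      rw [hN] at hxa
      refine (Valuation.map_sub _ _ _).trans_lt (max_lt ?_ ?_)
      all_goals
        rw [map_mul, mul_comm, ← one_mul (Valued.v c)]
        exact (mul_le_mul_right (hk1 _ 0) _).trans_lt
          (mul_lt_mul_of_pos_right (hxa _) (zero_lt_iff.2 hvc))
    have hdet : Valued.v (k⁻¹ * N).val.det = (Valued.v c ^ 2)⁻¹ := by
      rw [Units.val_mul, Matrix.det_mul, map_mul, hNdet, mul_one, Matrix.coe_units_inv,
        Matrix.det_nonsing_inv, Ring.inverse_eq_inv', map_inv₀, hkdet]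
    rw [← inv_smul_eq_iff, ← mul_smul, smul_diagVertex_one_iff hstd, hent, hdet, map_mul,
      map_inv₀, hkdet, mul_pow]
    have hpos : 0 < (Valued.v c ^ 2)⁻¹ ^ 2 := by
      rw [zero_lt_iff]
      exact pow_ne_zero _ (inv_ne_zero (pow_ne_zero _ hvc))
    refine (mul_lt_mul_of_pos_left (pow_lt_pow_left₀ hlt zero_le two_ne_zero) hpos).trans_eq ?_
    field_simp
  rw [hNdef, mul_smul, mul_smul, inv_smul_eq_iff] at hgoal
  exact hgoal

end Stabilizers

/-! ### Cyclic stabilizers -/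

/-- In a cyclic group of order `m * n`, every element of order `m` is the `n`-th power of a
generator. -/
theorem IsCyclic.exists_zpowers_eq_top_pow_eq {C : Type*} [Group C] [IsCyclic C] [Finite C]
    {m n : ℕ} (hcard : Nat.card C = m * n) {x : C} (hx : orderOf x = m) :
    ∃ y : C, Subgroup.zpowers y = ⊤ ∧ y ^ n = x := by
  obtain ⟨u, hu⟩ := IsCyclic.exists_generator (α := C)
  have hord : orderOf u = m * n := by rw [orderOf_eq_card_of_forall_mem_zpowers hu, hcard]
  have hmn : 0 < m * n := hcard ▸ Nat.card_pos
  have hm : 0 < m := Nat.pos_of_mul_pos_right hmn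
  have hn : 0 < n := Nat.pos_of_mul_pos_left hmn
  obtain ⟨k, rfl⟩ : ∃ k : ℕ, u ^ k = x := by
    have := hu x
    rwa [← mem_powers_iff_mem_zpowers] at this
  rw [orderOf_pow, hord] at hx
  have hgcd : (m * n).gcd k = n := by
    have h1 := Nat.div_mul_cancel (Nat.gcd_dvd_left (m * n) k)
    rw [hx] at h1
    exact Nat.eq_of_mul_eq_mul_left hm h1
  obtain ⟨l, rfl⟩ : n ∣ k := hgcd ▸ Nat.gcd_dvd_right _ _
  rw [mul_comm m n, Nat.gcd_mul_left, Nat.mul_eq_left hn.ne'] at hgcd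
  have : NeZero (m * n) := ⟨hmn.ne'⟩
  -- Lift the unit `l` modulo `m` to a unit modulo `m * n`.
  obtain ⟨w, hw⟩ := ZMod.unitsMap_surjective (Nat.dvd_mul_right m n)
    (ZMod.unitOfCoprime l (Nat.Coprime.symm hgcd))
  set j := (w : ZMod (m * n)).val with hj
  have hjcop : (m * n).Coprime j := (ZMod.val_coe_unit_coprime w).symm
  have hjl : j ≡ l [MOD m] := by
    rw [← ZMod.natCast_eq_natCast_iff]
    have := congrArg Units.val hw
    rw [ZMod.unitsMap_val, ZMod.coe_unitOfCoprime] at this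
    rw [← this, hj, ZMod.natCast_val]
  refine ⟨u ^ j, ?_, ?_⟩
  · refine Subgroup.eq_top_of_card_eq _ ?_
    rw [Nat.card_zpowers, orderOf_pow, hord, hjcop, Nat.div_one, hcard]
  · rw [← pow_mul, pow_eq_pow_iff_modEq, hord, mul_comm j n, mul_comm m n]
    exact hjl.mul_left' n

section Stabilizers

variable {F : Type*} [Field F] [DecidableEq (RatFunc F)] [Finite F]
variable {D : Type*} [DivisionRing D] [Algebra (RatFunc F) D]
variable {φ : KInf F ⊗[RatFunc F] D ≃ₐ[KInf F] Matrix (Fin 2) (Fin 2) (KInf F)}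
variable [Algebra F[X] D] [IsScalarTower F[X] (RatFunc F) D] {Λ : Subalgebra F[X] D}
variable {g : GL (Fin 2) (KInf F)}

/-- The stabilizer of `[g O∞²]` is the multiplicative group of the finite field of elements of `Λ`
preserving `g O∞²`. -/
theorem stabilizer_isCyclic_and_card (hΛ : IsOrder Λ) {γ : unitGroup φ Λ}
    (hγ : γ • g • stdVertex F = g • stdVertex F) (hγc : γ ∉ (scalarEmbedding φ Λ).range) :
    IsCyclic (MulAction.stabilizer (unitGroup φ Λ) (g • stdVertex F)) ∧
      Finite (MulAction.stabilizer (unitGroup φ Λ) (g • stdVertex F)) ∧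
      Nat.card (MulAction.stabilizer (unitGroup φ Λ) (g • stdVertex F)) =
        (Nat.card F - 1) * (Nat.card F + 1) := by
  have hfin := finite_latticeRing (φ := φ) (g := g) hΛ
  let f : MulAction.stabilizer (unitGroup φ Λ) (g • stdVertex F) →* latticeRing φ Λ g :=
    { toFun := fun δ => ⟨unitGroupToD φ Λ δ, (smul_eq_iff_mem_latticeRing hΛ).1 δ.2⟩
      map_one' := Subtype.ext (map_one _)
      map_mul' := fun δ ε => Subtype.ext (map_mul (unitGroupToD φ Λ) _ _) }
  have hf : Function.Injective f := fun δ ε h => by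
    have h' : (f δ : D) = (f ε : D) := by rw [h]
    change unitGroupToD φ Λ δ.1 = unitGroupToD φ Λ ε.1 at h'
    exact Subtype.ext (unitGroupToD_injective h')
  -- Every nonzero element of the finite field is a unit of `Λ` fixing the vertex.
  have hrange : Set.range f = {0}ᶜ := by
    ext x
    constructor
    · rintro ⟨δ, rfl⟩ h
      have : f δ * f δ⁻¹ = 1 := by rw [← map_mul, mul_inv_cancel, map_one]
      rw [show f δ = 0 from h, zero_mul] at this
      exact zero_ne_one this
    · intro hx
      obtain ⟨δ, h1, h2⟩ := exists_unitGroupToD_of_mem_latticeRing hΛ x.2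
        fun h => hx (Subtype.ext h)
      exact ⟨⟨δ, h2⟩, Subtype.ext h1⟩
  have hS : Finite (MulAction.stabilizer (unitGroup φ Λ) (g • stdVertex F)) :=
    Finite.of_injective f hf
  refine ⟨?_, hS, ?_⟩
  · let := (isField_latticeRing (φ := φ) (g := g) hΛ).toField
    exact isCyclic_of_injective_ringHom f hf
  · have hcard := card_latticeRing hΛ ((smul_eq_iff_mem_latticeRing hΛ).1 hγ) fun c hc =>
      hγc (mem_range_scalarEmbedding_iff.2 ⟨c, hc⟩)
    rw [Nat.card_congr (Equiv.ofInjective f hf), hrange, Nat.card_coe_set_eq, Set.ncard_compl,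
      hcard, Set.ncard_singleton, mul_comm, ← Nat.sq_sub_sq, one_pow]

/-! ### Terminal vertices -/

/-- A vertex whose stabilizer contains a non-constant element is terminal. -/
theorem isTerminal_of_notMem_range (hΛ : IsOrder Λ) {γ : unitGroup φ Λ}
    (hγ : γ • g • stdVertex F = g • stdVertex F) (hγc : γ ∉ (scalarEmbedding φ Λ).range) :
    ((btTree F).quotient (unitGroup φ Λ)).IsTerminal
      (MGraph.orbitMk (unitGroup φ Λ) (g • stdVertex F)) := by
  -- All edges starting in the orbit of the vertex are equivalent to `e₀`.
  let e₀ : BTEdge F := ⟨(_, _), btAdj_smul_diagVertex_one g⟩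
  refine ⟨MGraph.orbitMk _ e₀, rfl, ?_⟩
  intro e he
  induction e using Quotient.inductionOn' with | _ e =>
  obtain ⟨δ, hδ⟩ := MGraph.orbitMk_eq_iff.1
    (show MGraph.orbitMk (unitGroup φ Λ) ((btTree F).o e) = MGraph.orbitMk _ (g • stdVertex F)
      from he)
  obtain ⟨h, h1, h2⟩ := btAdj_iff.1 (δ⁻¹ • e).2
  have ho : (δ⁻¹ • e).1.1 = g • stdVertex F := by
    change δ⁻¹ • (btTree F).o e = _
    rw [← hδ, inv_smul_smul]
  have hk : (g⁻¹ * h) • stdVertex F = stdVertex F := by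
    rw [mul_smul, h1, ho, inv_smul_smul]
  obtain ⟨ε, hε1, hε2⟩ := exists_smul_diagVertex_one_eq hΛ hγ hγc hk
  rw [mul_smul, smul_inv_smul, h2] at hε2
  refine MGraph.orbitMk_eq_iff.2 ⟨δ * ε, ?_⟩
  have : ε • e₀ = δ⁻¹ • e := Subtype.ext (Prod.ext (hε1.trans ho.symm) hε2)
  rw [mul_smul, this, smul_inv_smul]

omit [Finite F] in
/-- The stabilizer of a terminal vertex contains a non-constant element, as constants fix all
edges while every vertex has several neighbours. -/
theorem exists_notMem_range_of_isTerminal (hΛ : IsOrder Λ)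
    (h : ((btTree F).quotient (unitGroup φ Λ)).IsTerminal
      (MGraph.orbitMk (unitGroup φ Λ) (g • stdVertex F))) :
    ∃ γ : unitGroup φ Λ, γ • g • stdVertex F = g • stdVertex F ∧
      γ ∉ (scalarEmbedding φ Λ).range := by
  let e₀ : BTEdge F := ⟨(_, _), btAdj_smul_diagVertex_one g⟩
  -- The edges `e₀` and `e₁` with the same origin are distinct and equivalent under some `γ`.
  let e₁ : BTEdge F := ⟨(_, _), btAdj_smul_diagVertex_one (g * swapInf F)⟩
  have ho : (btTree F).o e₁ = g • stdVertex F := by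
    change (g * swapInf F) • stdVertex F = _
    rw [mul_smul, swapInf_smul_stdVertex]
  obtain ⟨γ, hγ⟩ := MGraph.orbitMk_eq_iff.1 (h.unique (y₁ := MGraph.orbitMk _ e₁)
    (y₂ := MGraph.orbitMk _ e₀) (congrArg (MGraph.orbitMk _) ho) rfl)
  have h1 : γ • g • stdVertex F = (btTree F).o e₁ := congrArg (btTree F).o hγ
  have h2 : γ • g • diagVertex F 1 = (g * swapInf F) • diagVertex F 1 :=
    congrArg (btTree F).t hγ
  refine ⟨γ, h1.trans ho, ?_⟩
  rintro ⟨c, rfl⟩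
  rw [scalarEmbedding_smul hΛ, mul_smul, smul_left_cancel_iff, eq_comm,
    smul_diagVertex_one_iff swapInf_smul_stdVertex] at h2
  simp [swapInf] at h2

end Stabilizers

end

theorem mainTheorem6
    {F : Type*} [Field F] [Finite F] (hq : Odd (Nat.card F)) [DecidableEq (RatFunc F)]
    {D : Type*} [DivisionRing D] [Algebra (RatFunc F) D] [Algebra.IsCentral (RatFunc F) D]
    (hD : Module.finrank (RatFunc F) D = 4)
    [Algebra F[X] D] [IsScalarTower F[X] (RatFunc F) D]
    (φ : KInf F ⊗[RatFunc F] D ≃ₐ[KInf F] Matrix (Fin 2) (Fin 2) (KInf F))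
    (Λ : Subalgebra F[X] D) (hΛ : IsMaximalOrder Λ)
    (S Y : (btTree F).Subgraph)
    (hSY : MGraph.IsFundamentalDomain (unitGroup φ Λ) S Y)
    (g : MGraph.pairedEdges S Y → unitGroup φ Λ)
    (hg : MGraph.IsEdgePairing S Y g) :
    Nonempty (PresGroup (Nat.card F) (MGraph.terminalVertices (unitGroup φ Λ) S)
        (MGraph.pairedEdges S Y) ≃* unitGroup φ Λ) ∧
    ∀ g₀ : unitGroup φ Λ, Subgroup.zpowers g₀ = (scalarEmbedding φ Λ).range →
      (∃ gv : MGraph.terminalVertices (unitGroup φ Λ) S → unitGroup φ Λ, ∀ v,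
        Subgroup.zpowers (gv v) = MulAction.stabilizer (unitGroup φ Λ) (v : BTVertex F) ∧
          gv v ^ (Nat.card F + 1) = g₀) ∧
      ∀ gv : MGraph.terminalVertices (unitGroup φ Λ) S → unitGroup φ Λ,
        (∀ v, Subgroup.zpowers (gv v) =
            MulAction.stabilizer (unitGroup φ Λ) (v : BTVertex F) ∧
          gv v ^ (Nat.card F + 1) = g₀) →
        ∃ Φ : PresGroup (Nat.card F) (MGraph.terminalVertices (unitGroup φ Λ) S)
            (MGraph.pairedEdges S Y) ≃* unitGroup φ Λ,
          Φ (PresentedGroup.of Gen.zero) = g₀ ∧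
          (∀ v, Φ (PresentedGroup.of (Gen.vertex v)) = gv v) ∧
          ∀ e, Φ (PresentedGroup.of (Gen.edge e)) = g e := by
  have hord : IsOrder Λ := hΛ.prop
  have hq1 : 0 < Nat.card F - 1 := Nat.sub_pos_of_lt Finite.one_lt_card
  have horder : ∀ g₀ : unitGroup φ Λ, Subgroup.zpowers g₀ = (scalarEmbedding φ Λ).range →
      orderOf g₀ = Nat.card F - 1 := by
    intro g₀ h
    rw [← Nat.card_zpowers, h, ← Nat.card_congr
      (MonoidHom.ofInjective (scalarEmbedding_injective (φ := φ) (Λ := Λ))).toEquiv, Nat.card_units]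
  have hstab : ∀ v : MGraph.terminalVertices (unitGroup φ Λ) S,
      IsCyclic (MulAction.stabilizer (unitGroup φ Λ) (v : BTVertex F)) ∧
      Finite (MulAction.stabilizer (unitGroup φ Λ) (v : BTVertex F)) ∧
      Nat.card (MulAction.stabilizer (unitGroup φ Λ) (v : BTVertex F)) =
        (Nat.card F - 1) * (Nat.card F + 1) := by
    rintro ⟨v, hv⟩
    obtain ⟨h, rfl⟩ := exists_smul_stdVertex v
    obtain ⟨γ, h1, h2⟩ := exists_notMem_range_of_isTerminal hord hv.2
    exact stabilizer_isCyclic_and_card hord h1 h2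
  refine (and_iff_right_of_imp fun main => ?_).2 ?_
  · obtain ⟨u, hu⟩ := IsCyclic.exists_generator (α := Fˣ)
    have hu' : Subgroup.zpowers (scalarEmbedding φ Λ u) = (scalarEmbedding φ Λ).range := by
      rw [← MonoidHom.map_zpowers, (Subgroup.eq_top_iff' _).2 hu, ← MonoidHom.range_eq_map]
    obtain ⟨⟨gv, hgv⟩, h⟩ := main _ hu'
    obtain ⟨Φ, -⟩ := h gv hgv
    exact ⟨Φ⟩
  · intro g₀ hg₀
    obtain ⟨c, hc⟩ : g₀ ∈ (scalarEmbedding φ Λ).range := hg₀ ▸ Subgroup.mem_zpowers g₀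
    have hfix : ∀ x : BTVertex F, g₀ • x = x := fun x => hc ▸ scalarEmbedding_smul hord c x
    refine ⟨?_, ?_⟩
    · have hex : ∀ v : MGraph.terminalVertices (unitGroup φ Λ) S, ∃ y : unitGroup φ Λ,
          Subgroup.zpowers y = MulAction.stabilizer (unitGroup φ Λ) (v : BTVertex F) ∧
            y ^ (Nat.card F + 1) = g₀ := by
        intro v
        obtain ⟨h1, h2, h3⟩ := hstab v
        obtain ⟨y, hy, hy'⟩ := IsCyclic.exists_zpowers_eq_top_pow_eq h3
          (x := ⟨g₀, MulAction.mem_stabilizer_iff.2 (hfix v)⟩)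
          (by rw [Subgroup.orderOf_mk, horder g₀ hg₀])
        refine ⟨y, ?_, congrArg Subtype.val hy'⟩
        have := congrArg (Subgroup.map (Subgroup.subtype _)) hy
        rwa [MonoidHom.map_zpowers, ← MonoidHom.range_eq_map, Subgroup.range_subtype] at this
      choose gv hgv using hex
      exact ⟨gv, hgv⟩
    · intro gv hgv
      refine hSY.exists_mulEquiv_presGroup hg btTree_isTreeDist
        (fun γ x y => btDist_smul γ.1 x y) g₀ hfix (horder g₀ hg₀)
        (fun e => hc ▸ scalarEmbedding_commute c (g e)) ?_ ?_ gv (fun v => (hgv v).1)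
        (fun v => (hgv v).2) ?_
      · intro γ e he
        obtain ⟨h, h1, h2⟩ := btAdj_iff.1 e.2
        rw [hg₀]
        refine mem_range_of_smul_edge (g := h) hord ?_ ?_
        · rw [h1]; exact congrArg (btTree F).o he
        · rw [h2]; exact congrArg (btTree F).t he
      · intro v hv hvt γ hγ
        rw [hg₀]
        by_contra hγc
        obtain ⟨h, rfl⟩ := exists_smul_stdVertex v
        exact hvt ⟨hv, isTerminal_of_notMem_range hord hγ hγc⟩
      · intro v k hk
        have hgvord : orderOf (gv v) = (Nat.card F - 1) * (Nat.card F + 1) := by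
          rw [← Nat.card_zpowers, (hgv v).1, (hstab v).2.2]
        obtain ⟨j, hj⟩ := Subgroup.mem_zpowers_iff.1 hk
        -- `gv v ^ k` is a power of `g₀`, which has order `q - 1`, and `gv v` has order `q ^ 2 - 1`.
        have h1 : gv v ^ (((Nat.card F - 1 : ℕ) : ℤ) * k) = 1 := by
          rw [mul_comm, zpow_mul, ← hj, zpow_natCast, ← zpow_natCast, ← zpow_mul, mul_comm,
            zpow_mul, zpow_natCast, ← horder g₀ hg₀, pow_orderOf_eq_one, one_zpow]
        rw [← orderOf_dvd_iff_zpow_eq_one, hgvord, Nat.cast_mul] at h1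
        exact Int.dvd_of_mul_dvd_mul_left (by exact_mod_cast hq1.ne') h1
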